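/- Let $0<T<\infty$, $\omega=e^{2\pi i/3}$, $\Omega=\{0<x<\infty,\ 0<t<T\}$, and let $q,r:\bar\Omega\to\mathbb{C}$ be a solution in $\Omega$ of $$iq_t+\tfrac{1}{\sqrt3}q_{xx}+2irr_x=0,\qquad ir_t-\tfrac1{\sqrt3}r_{xx}+2iqq_x=0,$$ such that $q,r$ and their derivatives $q_x,q_{xx},q_t,r_x,r_{xx},r_t$ exist and are continuous on $\bar\Omega$ and $|q|,|r|,|q_x|,|r_x|$ are bounded, uniformly in $t$, by an integrable function of $x$ that tends to $0$ as $x\to\infty$. For $k\in\mathbb{C}$ put $J=\mathrm{diag}(1,\omega^2,\omega)$, $\mathcal L=kJ=\mathrm{diag}(l_1,l_2,l_3)$, $\mathcal Z=-k^2J^2=\mathrm{diag}(z_1,z_2,z_3)$, $$V_1=\begin{pmatrix}0&q&r\\ r&0&q\\ q&r&0\end{pmatrix},\quad V_2=k\begin{pmatrix}0&\omega q&\omega^2r\\ \omega r&0&q\\ \omega^2q&r&0\end{pmatrix}+\frac{i}{\sqrt3}\begin{pmatrix}0&q_x&-r_x\\ -r_x&0&q_x\\ q_x&-r_x&0\end{pmatrix}-\begin{pmatrix}0&r^2&q^2\\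 q^2&0&r^2\\ r^2&q^2&0\end{pmatrix},\quad \mathcal A=\begin{pmatrix}0&1&0\\0&0&1\\1&0&0\end{pmatrix}.$$ Let $\gamma_1$ (resp. $\gamma_2$) be the path from $(0,T)$ (resp. $(0,0)$) along $x=0$ to $(0,t)$ and then horizontally to $(x,t)$, and let $\gamma_3$ be the horizontal path from $(\infty,t)$ to $(x,t)$. For a path $\gamma$ and a matrix function $\mu$ on $\bar\Omega$ write $$I^\gamma_{ij}[\mu](x,t,k)=\int_\gamma e^{(l_i-l_j)(x-x')+(z_i-z_j)(t-t')}\big((V_1\,dx'+V_2\,dt')\mu\big)_{ij}(x',t',k).$$ Eigenfunctions $\mu_j$. For $j=1,2$ and $k\in\mathbb{C}$, $\mu_j(\cdot,\cdot,k)$ is the continuous solution on $\bar\Omega$ of $(\mu_j)_{ab}=\delta_{ab}+I^{\gamma_j}_{ab}[\mu_j]$. The $b$-th column of $\mu_3$ is the bounded continuous solution of the $b$-th column of the same equation with $\gamma_3$, for $k$ in $\omega\mathcal S$, $\omega^2\mathcal S$, $\mathcal S$ when $b=1,2,3$ respectively; $\mathcal S=D_1\cup D_2\cup D_3\cup D_4$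 with the $D_n$ below. Functions $M_n$. For $n=1,\dots,12$ let $D_n$ be the set of $k$ such that $\mathrm{Re}\,l_a<\mathrm{Re}\,l_b<\mathrm{Re}\,l_c$ and $\mathrm{Re}\,z_d<\mathrm{Re}\,z_e<\mathrm{Re}\,z_f$, where $(abc\,|\,def)$ is, for $n=1,\dots,12$ in order, $(321|132)$, $(321|312)$, $(312|321)$, $(312|231)$, $(132|213)$, $(132|123)$, $(123|132)$, $(123|312)$, $(213|321)$, $(213|231)$, $(231|213)$, $(231|123)$; that is, $D_n$ is the open sector $(n-1)\pi/6<\arg k<n\pi/6$. Put $\gamma^n_{ij}=\gamma_1$ if $\mathrm{Re}\,l_i<\mathrm{Re}\,l_j$ and $\mathrm{Re}\,z_i\ge\mathrm{Re}\,z_j$ on $D_n$, $\gamma^n_{ij}=\gamma_2$ if $\mathrm{Re}\,l_i<\mathrm{Re}\,l_j$ and $\mathrm{Re}\,z_i<\mathrm{Re}\,z_j$ on $D_n$, and $\gamma^n_{ij}=\gamma_3$ if $\mathrm{Re}\,l_i\ge\mathrm{Re}\,l_j$ on $D_n$. For $k\in\bar D_n$, $M_n(\cdot,\cdot,k)$ is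 the bounded continuous function on $\bar\Omega$ that solves the Lax pair $\mu_x-[\mathcal L,\mu]=V_1\mu$, $\mu_t-[\mathcal Z,\mu]=V_2\mu$ in $\Omega$ and the integral equations $(M_n)_{ij}=\delta_{ij}+I^{\gamma^n_{ij}}_{ij}[M_n]$, $i,j=1,2,3$. It is defined at those $k$, called regular for $M_n$, at which this problem is uniquely solvable (column by column); the other $k\in\bar D_n$ are the singularities of $M_n$. Let $M(x,t,k)=M_n(x,t,k)$ for $k\in D_n$, and call $k\in D_n$ regular for $M$ if it is regular for $M_n$. Indices $n$ are taken modulo $12$. Then, for all $(x,t)\in\bar\Omega$: 1. If $k\in\bigcup_nD_n$, then $\omega k\in\bigcup_nD_n$; $k$ is regular for $M$ if and only if $\omega k$ is, and in that case $$M(x,t,k)=\mathcal A\,M(x,t,\omega k)\,\mathcal A^{-1}.$$ Moreover, on the closed sectors: if $k\in\bar D_n$, then $\omega k\in\bar D_{n+4}$; $k$ is regular for $M_n$ if and only if $\omega k$ is regular for $M_{n+4}$, and in that case $M_n(x,t,k)=\mathcal A\,M_{n+4}(x,t,\omega k)\,\mathcal A^{-1}$. 2. For $j=1,2$ and every $k\in\mathbb{C}$,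 $\mu_j(\cdot,\cdot,k)$ is well defined (its equation has exactly one solution, in each column), and $\mu_j(x,t,k)=\mathcal A\,\mu_j(x,t,\omega k)\,\mathcal A^{-1}$. 3. For $k\in(\omega\mathcal S,\omega^2\mathcal S,\mathcal S)$, $\mu_3(x,t,k)=\mathcal A\,\mu_3(x,t,\omega k)\,\mathcal A^{-1}$. This means that for $b=1,2,3$ and $k$ in the $b$-th of these sets, $\omega k$ lies in the $(b+1)$-st (cyclically), the $b$-th column of $\mu_3(\cdot,\cdot,k)$ is well defined (exactly one bounded continuous solution), and the $b$-th columns of the two sides agree. -/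

import Mathlib

noncomputable section

namespace LaxThree

open Set Filter Topology MeasureTheory

/-- The primitive cube root of unity `ω = exp (2πi/3)`. -/
def ω : ℂ := Complex.exp (2 * Real.pi * Complex.I / 3)

/-- The closed half-line domain `{0 ≤ x < ∞, 0 ≤ t ≤ T}`. -/
def closedDomain (T : ℝ) : Set (ℝ × ℝ) := Ici 0 ×ˢ Icc 0 T

/-- The `x`-derivative of `f (x, t)` on the half-line `x ≥ 0` (one-sided at `x = 0`). -/
def dX (f : ℝ → ℝ → ℂ) (x t : ℝ) : ℂ := derivWithin (fun y => f y t) (Ici 0) x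

/-- The `t`-derivative of `f (x, t)` on `0 ≤ t ≤ T` (one-sided at the endpoints). -/
def dT (T : ℝ) (f : ℝ → ℝ → ℂ) (x t : ℝ) : ℂ := derivWithin (fun s => f x s) (Icc 0 T) t

/-- `f` is twice continuously differentiable in `x` and once in `t`, up to the boundary of the
half-line domain. -/
structure IsSmooth (T : ℝ) (f : ℝ → ℝ → ℂ) : Prop where
  diff_x : ∀ x t, (x, t) ∈ closedDomain T →
    DifferentiableWithinAt ℝ (fun y => f y t) (Ici 0) x
  diff_xx : ∀ x t, (x, t) ∈ closedDomain T →
    DifferentiableWithinAt ℝ (fun y => dX f y t) (Ici 0) x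
  diff_t : ∀ x t, (x, t) ∈ closedDomain T →
    DifferentiableWithinAt ℝ (fun s => f x s) (Icc 0 T) t
  cont : ContinuousOn (fun p : ℝ × ℝ => f p.1 p.2) (closedDomain T)
  cont_x : ContinuousOn (fun p : ℝ × ℝ => dX f p.1 p.2) (closedDomain T)
  cont_xx : ContinuousOn (fun p : ℝ × ℝ => dX (dX f) p.1 p.2) (closedDomain T)
  cont_t : ContinuousOn (fun p : ℝ × ℝ => dT T f p.1 p.2) (closedDomain T)

/-- `f` and `f_x` decay as `x → ∞`, uniformly in `t`, and are dominated by an integrable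
function of `x`. -/
def Decays (T : ℝ) (f : ℝ → ℝ → ℂ) : Prop :=
  ∃ m : ℝ → ℝ, IntegrableOn m (Ioi 0) ∧ Tendsto m atTop (𝓝 0) ∧
    ∀ x t, (x, t) ∈ closedDomain T → ‖f x t‖ ≤ m x ∧ ‖dX f x t‖ ≤ m x

/-- `{q, r}` is a smooth decaying solution of the system
`i q_t + q_xx / √3 + 2 i r r_x = 0`, `i r_t - r_xx / √3 + 2 i q q_x = 0` on the half-line. -/
structure IsSolution (T : ℝ) (q r : ℝ → ℝ → ℂ) : Prop where
  smooth_q : IsSmooth T q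
  smooth_r : IsSmooth T r
  decays_q : Decays T q
  decays_r : Decays T r
  eq_q : ∀ x t, 0 < x → 0 < t → t < T →
    Complex.I * dT T q x t + 1 / (Real.sqrt 3 : ℂ) * dX (dX q) x t
      + 2 * Complex.I * r x t * dX r x t = 0
  eq_r : ∀ x t, 0 < x → 0 < t → t < T →
    Complex.I * dT T r x t - 1 / (Real.sqrt 3 : ℂ) * dX (dX r) x t
      + 2 * Complex.I * q x t * dX q x t = 0

/-- The potential `V₁(x,t)` of the `x`-part of the Lax pair. -/
def V1 (q r : ℝ → ℝ → ℂ) (x t : ℝ) : Matrix (Fin 3) (Fin 3) ℂ :=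
  !![0, q x t, r x t;
     r x t, 0, q x t;
     q x t, r x t, 0]

/-- The potential `V₂(x,t,k) = k V₂⁽¹⁾ + V₂⁽⁰⁾` of the `t`-part of the Lax pair. -/
def V2 (q r : ℝ → ℝ → ℂ) (x t : ℝ) (k : ℂ) : Matrix (Fin 3) (Fin 3) ℂ :=
  k • !![0, ω * q x t, ω ^ 2 * r x t;
         ω * r x t, 0, q x t;
         ω ^ 2 * q x t, r x t, 0]
  + (Complex.I / (Real.sqrt 3 : ℂ)) •
      !![0, dX q x t, -dX r x t;
         -dX r x t, 0, dX q x t;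
         dX q x t, -dX r x t, 0]
  - !![0, r x t ^ 2, q x t ^ 2;
       q x t ^ 2, 0, r x t ^ 2;
       r x t ^ 2, q x t ^ 2, 0]

/-- The diagonal entries of `J = diag (1, ω², ω)`. -/
def Jd : Fin 3 → ℂ := ![1, ω ^ 2, ω]

/-- The diagonal entries of `ℒ = k J`. -/
def l (k : ℂ) (i : Fin 3) : ℂ := k * Jd i

/-- The diagonal entries of `𝒵 = -k² J²`. -/
def z (k : ℂ) (i : Fin 3) : ℂ := -(k ^ 2 * Jd i ^ 2)

/-- The cyclic permutation matrix. -/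
def 𝒜 : Matrix (Fin 3) (Fin 3) ℂ := !![0, 1, 0; 0, 0, 1; 1, 0, 0]

/-- `{k | Re l_a < Re l_b < Re l_c and Re z_d < Re z_e < Re z_f}`. -/
def sector (a b c d e f : Fin 3) : Set ℂ :=
  {k | (l k a).re < (l k b).re ∧ (l k b).re < (l k c).re ∧
       (z k d).re < (z k e).re ∧ (z k e).re < (z k f).re}

/-- The twelve open sectors `D₁, …, D₁₂`; the index `n : Fin 12` stands for `D_{n+1}`, and
addition in `Fin 12` is modulo 12. Likewise the matrix index `i : Fin 3` stands for `i + 1`. -/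
def D : Fin 12 → Set ℂ :=
  ![sector 2 1 0 0 2 1,
    sector 2 1 0 2 0 1,
    sector 2 0 1 2 1 0,
    sector 2 0 1 1 2 0,
    sector 0 2 1 1 0 2,
    sector 0 2 1 0 1 2,
    sector 0 1 2 0 2 1,
    sector 0 1 2 2 0 1,
    sector 1 0 2 2 1 0,
    sector 1 0 2 1 2 0,
    sector 1 2 0 1 0 2,
    sector 1 2 0 0 1 2]

/-- Names of the three contours ending at `(x,t)`: `γ₁` runs from `(0,T)` along `x = 0` to `(0,t)`
and then horizontally to `(x,t)`; `γ₂` runs from `(0,0)` along `x = 0` to `(0,t)` and then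
horizontally to `(x,t)`; `γ₃` runs horizontally from `(∞,t)` to `(x,t)`. -/
inductive Contour where
  | γ₁ : Contour
  | γ₂ : Contour
  | γ₃ : Contour

open Classical in
/-- The contours `γⁿ_{ij}`, determined by the ordering of the real parts that holds throughout
`D n`. -/
def contour (n : Fin 12) (i j : Fin 3) : Contour :=
  if ∀ k ∈ D n, (l k i).re < (l k j).re ∧ (z k j).re ≤ (z k i).re then Contour.γ₁
  else if ∀ k ∈ D n, (l k i).re < (l k j).re ∧ (z k i).re < (z k j).re then Contour.γ₂
  else Contour.γ₃

/-- The factor `e^{(l_i - l_j) ξ + (z_i - z_j) τ}` by which `e^{ξ ℒ^ + τ 𝒵^}` multiplies the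
`(i,j)` entry of a matrix, where `ℒ^ X = [ℒ, X]` and `𝒵^ X = [𝒵, X]`. -/
def expFactor (k : ℂ) (i j : Fin 3) (ξ τ : ℝ) : ℂ :=
  Complex.exp ((l k i - l k j) * ξ + (z k i - z k j) * τ)

/-- The integral over the horizontal segment from `(0,t)` to `(x,t)` of
`(e^{(x-x')ℒ^ + (t-t')𝒵^} (V₁ dx' + V₂ dt') μ)_{ij}`, where `v` is the `j`-th column of `μ`. -/
def horizontal (q r : ℝ → ℝ → ℂ) (k : ℂ) (i j : Fin 3) (v : ℝ → ℝ → Fin 3 → ℂ) (x t : ℝ) : ℂ :=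
  ∫ x' in (0 : ℝ)..x, expFactor k i j (x - x') 0 * ((V1 q r x' t).mulVec (v x' t)) i

/-- The integral of the same form over the vertical segment from `(0,t₀)` to `(0,t)`. -/
def vertical (q r : ℝ → ℝ → ℂ) (k : ℂ) (i j : Fin 3) (v : ℝ → ℝ → Fin 3 → ℂ) (t₀ x t : ℝ) : ℂ :=
  ∫ t' in t₀..t, expFactor k i j x (t - t') * ((V2 q r 0 t' k).mulVec (v 0 t')) i

/-- The integral of the same form over one of the contours `γ₁`, `γ₂`, `γ₃`. -/
def contourIntegral (T : ℝ) (q r : ℝ → ℝ → ℂ) (k : ℂ) (i j : Fin 3)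
    (v : ℝ → ℝ → Fin 3 → ℂ) (x t : ℝ) : Contour → ℂ
  | Contour.γ₁ => vertical q r k i j v T x t + horizontal q r k i j v x t
  | Contour.γ₂ => vertical q r k i j v 0 x t + horizontal q r k i j v x t
  | Contour.γ₃ =>
      -∫ x' in Ioi x, expFactor k i j (x - x') 0 * ((V1 q r x' t).mulVec (v x' t)) i

/-- `v` satisfies the `j`-th column of the integral equations in which the `i`-th entry of the
column is integrated along `c i`. -/
def SolvesColumn (T : ℝ) (q r : ℝ → ℝ → ℂ) (k : ℂ) (c : Fin 3 → Contour) (j : Fin 3)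
    (v : ℝ → ℝ → Fin 3 → ℂ) : Prop :=
  ∀ x t, (x, t) ∈ closedDomain T → ∀ i,
    v x t i = (1 : Matrix (Fin 3) (Fin 3) ℂ) i j + contourIntegral T q r k i j v x t (c i)

/-- Continuity on the closed half-line domain. -/
def ContOnDomain (T : ℝ) (v : ℝ → ℝ → Fin 3 → ℂ) : Prop :=
  ContinuousOn (fun p : ℝ × ℝ => v p.1 p.2) (closedDomain T)

/-- Boundedness on the closed half-line domain. -/
def BddOnDomain (T : ℝ) (v : ℝ → ℝ → Fin 3 → ℂ) : Prop :=
  ∃ C : ℝ, ∀ x t, (x, t) ∈ closedDomain T → ‖v x t‖ ≤ C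

/-- `v` is the `j`-th column of a solution `μ` of the Lax pair
`μ_x - [ℒ, μ] = V₁ μ`, `μ_t - [𝒵, μ] = V₂ μ` in `{0 < x < ∞, 0 < t < T}`. -/
def LaxColumn (T : ℝ) (q r : ℝ → ℝ → ℂ) (k : ℂ) (j : Fin 3) (v : ℝ → ℝ → Fin 3 → ℂ) : Prop :=
  ∀ x t, 0 < x → 0 < t → t < T → ∀ i,
    HasDerivAt (fun y => v y t i)
      ((l k i - l k j) * v x t i + ((V1 q r x t).mulVec (v x t)) i) x ∧
    HasDerivAt (fun s => v x s i)
      ((z k i - z k j) * v x t i + ((V2 q r x t k).mulVec (v x t)) i) t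

/-- `v` is a `j`-th column of the eigenfunction `μ` attached to the contour `γ`. For `γ₃` it is
required to be bounded, so that the integrals from `x = ∞` converge. -/
def IsMuColumn (T : ℝ) (q r : ℝ → ℝ → ℂ) (γ : Contour) (k : ℂ) (j : Fin 3)
    (v : ℝ → ℝ → Fin 3 → ℂ) : Prop :=
  ContOnDomain T v ∧ (γ = Contour.γ₃ → BddOnDomain T v) ∧ SolvesColumn T q r k (fun _ => γ) j v

/-- `v` is a `j`-th column of the eigenfunction `M_n`: a bounded continuous solution of the Lax
pair and of the integral equations with contours `γⁿ_{ij}`. -/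
def IsMnColumn (T : ℝ) (q r : ℝ → ℝ → ℂ) (n : Fin 12) (k : ℂ) (j : Fin 3)
    (v : ℝ → ℝ → Fin 3 → ℂ) : Prop :=
  ContOnDomain T v ∧ BddOnDomain T v ∧ LaxColumn T q r k j v ∧
    SolvesColumn T q r k (fun i => contour n i j) j v

/-- The problem `P` has exactly one solution on the closed half-line domain. -/
def WellPosed (T : ℝ) (P : (ℝ → ℝ → Fin 3 → ℂ) → Prop) : Prop :=
  (∃ v, P v) ∧ ∀ v w, P v → P w → ∀ x t, (x, t) ∈ closedDomain T → v x t = w x t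

open Classical in
/-- The solution of a well-posed problem (and `0` if the problem is not well-posed). -/
def theSolution (T : ℝ) (P : (ℝ → ℝ → Fin 3 → ℂ) → Prop) : ℝ → ℝ → Fin 3 → ℂ :=
  if h : WellPosed T P then h.1.choose else 0

/-- The eigenfunctions `μ₁`, `μ₂`, `μ₃`, attached to the contours `γ₁`, `γ₂`, `γ₃`. -/
def mu (T : ℝ) (q r : ℝ → ℝ → ℂ) (γ : Contour) (x t : ℝ) (k : ℂ) : Matrix (Fin 3) (Fin 3) ℂ :=
  Matrix.of fun i j => theSolution T (IsMuColumn T q r γ k j) x t i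

/-- The eigenfunctions `M_n`. -/
def Mn (T : ℝ) (q r : ℝ → ℝ → ℂ) (n : Fin 12) (x t : ℝ) (k : ℂ) : Matrix (Fin 3) (Fin 3) ℂ :=
  Matrix.of fun i j => theSolution T (IsMnColumn T q r n k j) x t i

/-- `k` is not a singularity of `M_n`: the system of integral equations that defines `M_n` is
uniquely solvable at `k`. -/
def MnRegular (T : ℝ) (q r : ℝ → ℝ → ℂ) (n : Fin 12) (k : ℂ) : Prop :=
  ∀ j, WellPosed T (IsMnColumn T q r n k j)

open Classical in
/-- The sectionally analytic function `M`, equal to `M_n` on `D n` (the `D n` are pairwise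
disjoint). It is only meaningful on the union of the `D n`. -/
def M (T : ℝ) (q r : ℝ → ℝ → ℂ) (x t : ℝ) (k : ℂ) : Matrix (Fin 3) (Fin 3) ℂ :=
  if h : ∃ n, k ∈ D n then Mn T q r h.choose x t k else 0

/-- `k` belongs to one of the sectors and is not a singularity of `M`. -/
def MRegular (T : ℝ) (q r : ℝ → ℝ → ℂ) (k : ℂ) : Prop :=
  ∃ n, k ∈ D n ∧ MnRegular T q r n k

/-- The set `𝒮 = D₁ ∪ D₂ ∪ D₃ ∪ D₄`. -/
def 𝒮 : Set ℂ := D 0 ∪ D 1 ∪ D 2 ∪ D 3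

/-- The sets `ω𝒮`, `ω²𝒮`, `𝒮` on which the three columns of `μ₃` are defined. -/
def columnDomain : Fin 3 → Set ℂ :=
  ![(fun k => ω * k) '' 𝒮, (fun k => ω ^ 2 * k) '' 𝒮, 𝒮]

end LaxThree

end

namespace LaxThree

open Set Filter Topology MeasureTheory

/-! ### The rotation `k ↦ ω k` -/

/-! Replacing `k` by `ω k` and raising every matrix index by one (mod 3) leaves all the data
unchanged: `l_succ` and `z_succ` for the exponents, `V1_succ` and `V2_succ` for the potentials.
Hence a column `v` solves the `(j+1)`-st problem at `ω k` exactly when its relabelling `shift v`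
solves the `j`-th problem at `k`. The contours of `M_n` depend only on the order of the real parts,
so they follow the rotation `D n → D (n + 4)` (`contour_succ`). Since `shift` is onto,
well-posedness passes between the two problems (`wellPosed_shift`), and uniqueness identifies their
solutions (`theSolution_shift`). Conjugation by `𝒜` is the same index shift (`conj_𝒜_apply`). For
`M_n` and `M` this is the whole argument, because unique solvability is part of regularity.

For `μ₁`, `μ₂`, `μ₃` unique solvability has to be proved. Each integral operator halves a suitable
weighted supremum norm, so existence follows from Banach's fixed point theorem and uniqueness from
iterating the halving. For `μ₁` and `μ₂` the weight grows exponentially away from the start of the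
path (`exists_pathWeight_halving`). For `μ₃` the kernel is bounded by 1 because `Re l_j` is minimal;
the weight `1 + exp (b (N - x))` combines a small tail of the potential beyond `N` with exponential
damping before `N` (`exists_tailWeight_halving`). -/

theorem omega_pow_three : ω ^ 3 = 1 := by
  rw [ω, ← Complex.exp_nat_mul, ← Complex.exp_two_pi_mul_I]
  congr 1
  push_cast
  ring

theorem omega_ne_zero : ω ≠ 0 := Complex.exp_ne_zero _

theorem Jd_succ (i : Fin 3) : ω * Jd (i + 1) = Jd i := by
  have h := omega_pow_three
  fin_cases i <;> simp [Jd]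
  · linear_combination h
  · ring

theorem l_succ (k : ℂ) (i : Fin 3) : l (ω * k) (i + 1) = l k i := by
  rw [l, l, ← Jd_succ i]
  ring

theorem z_succ (k : ℂ) (i : Fin 3) : z (ω * k) (i + 1) = z k i := by
  rw [z, z, ← Jd_succ i]
  ring

theorem V1_succ (q r : ℝ → ℝ → ℂ) (x t : ℝ) (i j : Fin 3) :
    V1 q r x t (i + 1) (j + 1) = V1 q r x t i j := by
  fin_cases i <;> fin_cases j <;> rfl

theorem V2_succ (q r : ℝ → ℝ → ℂ) (x t : ℝ) (k : ℂ) (i j : Fin 3) :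
    V2 q r x t (ω * k) (i + 1) (j + 1) = V2 q r x t k i j := by
  have h := omega_pow_three
  fin_cases i <;> fin_cases j <;> simp [V2] <;> try ring1
  -- The two entries whose coefficient is `ω ^ 2` after the shift and `1` before it: only there does
  -- `ω ^ 3 = 1` enter.
  · linear_combination k * q x t * h
  · linear_combination k * r x t * h

theorem expFactor_succ (k : ℂ) (i j : Fin 3) (ξ τ : ℝ) :
    expFactor (ω * k) (i + 1) (j + 1) ξ τ = expFactor k i j ξ τ := by
  simp only [expFactor, l_succ, z_succ]

theorem one_succ (i j : Fin 3) :
    (1 : Matrix (Fin 3) (Fin 3) ℂ) (i + 1) (j + 1) = (1 : Matrix (Fin 3) (Fin 3) ℂ) i j := by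
  simp [Matrix.one_apply]

/-- `𝒜` is a permutation matrix, so its inverse is its transpose. -/
theorem conj_𝒜_apply (N : Matrix (Fin 3) (Fin 3) ℂ) (i j : Fin 3) :
    (𝒜 * N * 𝒜⁻¹) i j = N (i + 1) (j + 1) := by
  have h : (𝒜⁻¹ : Matrix (Fin 3) (Fin 3) ℂ) = 𝒜.transpose := by
    apply Matrix.inv_eq_right_inv
    ext i j
    fin_cases i <;> fin_cases j <;> simp [𝒜, Matrix.mul_apply, Fin.sum_univ_three]
  simp only [h, Matrix.mul_apply, Matrix.transpose_apply]
  fin_cases i <;> fin_cases j <;> simp [𝒜, Fin.sum_univ_three]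

/-- The cyclic relabelling of the entries of a column. -/
def shift (v : ℝ → ℝ → Fin 3 → ℂ) : ℝ → ℝ → Fin 3 → ℂ := fun x t i => v x t (i + 1)

theorem shift_surjective : Function.Surjective shift := fun v =>
  ⟨fun x t i => v x t (i - 1), by funext x t i; simp [shift]⟩

theorem forall_fin_three_succ {p : Fin 3 → Prop} : (∀ i, p (i + 1)) ↔ ∀ i, p i :=
  (Equiv.addRight (1 : Fin 3)).surjective.forall.symm

theorem mulVec_succ {V W : Matrix (Fin 3) (Fin 3) ℂ} (h : ∀ i j, W (i + 1) (j + 1) = V i j)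
    (u : Fin 3 → ℂ) (i : Fin 3) : W.mulVec u (i + 1) = V.mulVec (fun j => u (j + 1)) i := by
  simp only [Matrix.mulVec, dotProduct, ← h]
  exact (Equiv.sum_comp (Equiv.addRight (1 : Fin 3)) fun j => W (i + 1) j * u j).symm

theorem V1_mulVec_succ (q r : ℝ → ℝ → ℂ) (x t : ℝ) (u : Fin 3 → ℂ) (i : Fin 3) :
    (V1 q r x t).mulVec u (i + 1) = (V1 q r x t).mulVec (fun j => u (j + 1)) i :=
  mulVec_succ (V1_succ q r x t) u i

theorem V2_mulVec_succ (q r : ℝ → ℝ → ℂ) (x t : ℝ) (k : ℂ) (u : Fin 3 → ℂ) (i : Fin 3) :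
    (V2 q r x t (ω * k)).mulVec u (i + 1) = (V2 q r x t k).mulVec (fun j => u (j + 1)) i :=
  mulVec_succ (V2_succ q r x t k) u i

/-- The integrands agree pointwise and the contours involve neither `k` nor the indices, so no
integrability is needed. -/
theorem contourIntegral_shift (T : ℝ) (q r : ℝ → ℝ → ℂ) (k : ℂ) (i j : Fin 3)
    (v : ℝ → ℝ → Fin 3 → ℂ) (x t : ℝ) (c : Contour) :
    contourIntegral T q r k i j (shift v) x t c =
      contourIntegral T q r (ω * k) (i + 1) (j + 1) v x t c := by
  cases c <;> simp only [contourIntegral, vertical, horizontal, expFactor_succ, V1_mulVec_succ,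
    V2_mulVec_succ] <;> rfl

theorem contOnDomain_shift {T : ℝ} {v : ℝ → ℝ → Fin 3 → ℂ} :
    ContOnDomain T (shift v) ↔ ContOnDomain T v := by
  simp only [ContOnDomain, continuousOn_pi]
  exact forall_fin_three_succ (p := fun i =>
    ContinuousOn (fun y : ℝ × ℝ => v y.1 y.2 i) (closedDomain T))

theorem norm_shift (v : ℝ → ℝ → Fin 3 → ℂ) (x t : ℝ) : ‖shift v x t‖ = ‖v x t‖ := by
  refine eq_of_forall_ge_iff fun C => ?_
  simp only [pi_norm_le_iff_of_nonempty]
  exact forall_fin_three_succ (p := fun i => ‖v x t i‖ ≤ C)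

theorem bddOnDomain_shift {T : ℝ} {v : ℝ → ℝ → Fin 3 → ℂ} :
    BddOnDomain T (shift v) ↔ BddOnDomain T v := by
  simp only [BddOnDomain, norm_shift]

theorem solvesColumn_shift {T : ℝ} {q r : ℝ → ℝ → ℂ} {k : ℂ} {c c' : Fin 3 → Contour} {j : Fin 3}
    {v : ℝ → ℝ → Fin 3 → ℂ} (hc : ∀ i, c' (i + 1) = c i) :
    SolvesColumn T q r k c j (shift v) ↔ SolvesColumn T q r (ω * k) c' (j + 1) v := by
  refine forall₃_congr fun x t _ => Iff.trans (forall_congr' fun i => ?_)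
    (forall_fin_three_succ (p := fun i => v x t i = (1 : Matrix (Fin 3) (Fin 3) ℂ) i (j + 1) +
      contourIntegral T q r (ω * k) i (j + 1) v x t (c' i)))
  rw [contourIntegral_shift, hc, one_succ, shift]

theorem laxColumn_shift {T : ℝ} {q r : ℝ → ℝ → ℂ} {k : ℂ} {j : Fin 3} {v : ℝ → ℝ → Fin 3 → ℂ} :
    LaxColumn T q r k j (shift v) ↔ LaxColumn T q r (ω * k) (j + 1) v := by
  refine forall₅_congr fun x t _ _ _ => ?_
  refine Iff.trans (forall_congr' fun i => ?_) (forall_fin_three_succ (p := fun i =>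
    HasDerivAt (fun y => v y t i) ((l (ω * k) i - l (ω * k) (j + 1)) * v x t i +
      ((V1 q r x t).mulVec (v x t)) i) x ∧
    HasDerivAt (fun s => v x s i) ((z (ω * k) i - z (ω * k) (j + 1)) * v x t i +
      ((V2 q r x t (ω * k)).mulVec (v x t)) i) t))
  simp only [l_succ, z_succ, V1_mulVec_succ, V2_mulVec_succ]
  rfl

theorem isMuColumn_shift {T : ℝ} {q r : ℝ → ℝ → ℂ} {γ : Contour} {k : ℂ} {j : Fin 3}
    (v : ℝ → ℝ → Fin 3 → ℂ) :
    IsMuColumn T q r γ k j (shift v) ↔ IsMuColumn T q r γ (ω * k) (j + 1) v := by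
  rw [IsMuColumn, IsMuColumn, contOnDomain_shift, bddOnDomain_shift,
    solvesColumn_shift (c' := fun _ => γ) fun _ => rfl]

/-! ### The sectors -/

/-- Rotation by `2π/3` crosses four sectors of angle `π/6`. In terms of orderings, raising each
label by one moves the list defining `D` four places on. -/
theorem omega_mul_mem_D {n : Fin 12} {k : ℂ} : ω * k ∈ D (n + 4) ↔ k ∈ D n := by
  have l₀ : l (ω * k) 0 = l k 2 := l_succ k 2
  have l₁ : l (ω * k) 1 = l k 0 := l_succ k 0
  have l₂ : l (ω * k) 2 = l k 1 := l_succ k 1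
  have z₀ : z (ω * k) 0 = z k 2 := z_succ k 2
  have z₁ : z (ω * k) 1 = z k 0 := z_succ k 0
  have z₂ : z (ω * k) 2 = z k 1 := z_succ k 1
  fin_cases n <;> simp [D, sector, l₀, l₁, l₂, z₀, z₁, z₂]

theorem forall_D_succ {n : Fin 12} {p : ℂ → Prop} :
    (∀ k ∈ D (n + 4), p k) ↔ ∀ k ∈ D n, p (ω * k) := by
  refine ⟨fun h k hk => h _ (omega_mul_mem_D.2 hk), fun h k hk => ?_⟩
  have hk' : ω * (ω⁻¹ * k) = k := mul_inv_cancel_left₀ omega_ne_zero k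
  rw [← hk'] at hk ⊢
  exact h _ (omega_mul_mem_D.1 hk)

/-- The conditions selecting a contour quantify over the whole sector, and multiplication by `ω`
maps `D n` onto `D (n + 4)`. -/
theorem contour_succ (n : Fin 12) (i j : Fin 3) :
    contour (n + 4) (i + 1) (j + 1) = contour n i j := by
  have h₁ := forall_D_succ (n := n) (p := fun k =>
    (l k (i + 1)).re < (l k (j + 1)).re ∧ (z k (j + 1)).re ≤ (z k (i + 1)).re)
  have h₂ := forall_D_succ (n := n) (p := fun k =>
    (l k (i + 1)).re < (l k (j + 1)).re ∧ (z k (i + 1)).re < (z k (j + 1)).re)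
  simp only [l_succ, z_succ] at h₁ h₂
  unfold contour
  classical exact if_congr h₁ rfl (if_congr h₂ rfl rfl)

theorem omega_mul_mem_closure_D {n : Fin 12} {k : ℂ} (hk : k ∈ closure (D n)) :
    ω * k ∈ closure (D (n + 4)) :=
  map_mem_closure (continuous_const_mul ω) hk fun _ h => omega_mul_mem_D.2 h

/-- Two different orderings contain opposite strict inequalities. This pins down the index chosen in
the definition of `M`. -/
theorem D_disjoint {n m : Fin 12} {k : ℂ} (hn : k ∈ D n) (hm : k ∈ D m) : n = m := by
  fin_cases n <;> obtain ⟨h₁, h₂, h₃, h₄⟩ := hn <;> fin_cases m <;> first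
    | rfl
    | (obtain ⟨g₁, g₂, g₃, g₄⟩ := hm
       exfalso
       linarith)

theorem isMnColumn_shift {T : ℝ} {q r : ℝ → ℝ → ℂ} {n : Fin 12} {k : ℂ} {j : Fin 3}
    (v : ℝ → ℝ → Fin 3 → ℂ) :
    IsMnColumn T q r n k j (shift v) ↔ IsMnColumn T q r (n + 4) (ω * k) (j + 1) v := by
  rw [IsMnColumn, IsMnColumn, contOnDomain_shift, bddOnDomain_shift, laxColumn_shift,
    solvesColumn_shift (c' := fun i => contour (n + 4) i (j + 1)) fun i => contour_succ n i j]

/-! ### Well-posed problems that correspond under the cyclic relabelling -/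

theorem theSolution_spec {T : ℝ} {P : (ℝ → ℝ → Fin 3 → ℂ) → Prop} (h : WellPosed T P) :
    P (theSolution T P) := by
  rw [theSolution, dif_pos h]
  exact h.1.choose_spec

/-- Every candidate for `P` has the form `shift v`, and two shifted columns agree at a point exactly
when the original ones do. -/
theorem wellPosed_shift {T : ℝ} {P Q : (ℝ → ℝ → Fin 3 → ℂ) → Prop} (h : ∀ v, P (shift v) ↔ Q v) :
    WellPosed T P ↔ WellPosed T Q := by
  rw [WellPosed, WellPosed, shift_surjective.exists, shift_surjective.forall₂]
  simp only [h]
  refine and_congr_right fun _ => forall₄_congr fun v w _ _ => forall₃_congr fun x t _ => ?_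
  rw [funext_iff, funext_iff]
  exact forall_fin_three_succ (p := fun i => v x t i = w x t i)

/-- The shifted solution of `Q` solves `P`, so uniqueness for `P` forces it to be the chosen
solution. -/
theorem theSolution_shift {T : ℝ} {P Q : (ℝ → ℝ → Fin 3 → ℂ) → Prop}
    (h : ∀ v, P (shift v) ↔ Q v) (hP : WellPosed T P) {x t : ℝ} (hxt : (x, t) ∈ closedDomain T)
    (i : Fin 3) : theSolution T P x t i = theSolution T Q x t (i + 1) :=
  congrFun (hP.2 _ _ (theSolution_spec hP)
    ((h _).2 (theSolution_spec ((wellPosed_shift h).1 hP))) x t hxt) i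

theorem MnRegular_succ {T : ℝ} {q r : ℝ → ℝ → ℂ} {n : Fin 12} {k : ℂ} :
    MnRegular T q r n k ↔ MnRegular T q r (n + 4) (ω * k) :=
  (forall_congr' fun _ => wellPosed_shift isMnColumn_shift).trans
    (forall_fin_three_succ (p := fun j => WellPosed T (IsMnColumn T q r (n + 4) (ω * k) j)))

theorem Mn_succ {T : ℝ} {q r : ℝ → ℝ → ℂ} {n : Fin 12} {k : ℂ} (h : MnRegular T q r n k)
    {x t : ℝ} (hxt : (x, t) ∈ closedDomain T) :
    Mn T q r n x t k = 𝒜 * Mn T q r (n + 4) x t (ω * k) * 𝒜⁻¹ := by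
  ext i j
  rw [conj_𝒜_apply]
  exact theSolution_shift isMnColumn_shift (h j) hxt i

theorem MRegular_iff {T : ℝ} {q r : ℝ → ℝ → ℂ} {n : Fin 12} {k : ℂ} (hk : k ∈ D n) :
    MRegular T q r k ↔ MnRegular T q r n k :=
  ⟨fun ⟨_, hm, h⟩ => D_disjoint hm hk ▸ h, fun h => ⟨n, hk, h⟩⟩

theorem M_eq_Mn {T : ℝ} {q r : ℝ → ℝ → ℂ} {n : Fin 12} {k : ℂ} (hk : k ∈ D n) (x t : ℝ) :
    M T q r x t k = Mn T q r n x t k := by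
  have h : ∃ n, k ∈ D n := ⟨n, hk⟩
  rw [M, dif_pos h, D_disjoint h.choose_spec hk]

theorem mu_succ {T : ℝ} {q r : ℝ → ℝ → ℂ} {γ : Contour} {k : ℂ} {j : Fin 3}
    (h : WellPosed T (IsMuColumn T q r γ k j)) {x t : ℝ} (hxt : (x, t) ∈ closedDomain T)
    (i : Fin 3) :
    mu T q r γ x t k i j = (𝒜 * mu T q r γ x t (ω * k) * 𝒜⁻¹) i j := by
  rw [conj_𝒜_apply]
  exact theSolution_shift isMuColumn_shift h hxt i

theorem omega_mul_mem_columnDomain {j : Fin 3} {k : ℂ} (hk : k ∈ columnDomain j) :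
    ω * k ∈ columnDomain (j + 1) := by
  fin_cases j
  · obtain ⟨s, hs, rfl⟩ := hk
    exact ⟨s, hs, by ring⟩
  · obtain ⟨s, hs, rfl⟩ := hk
    have : ω * (ω ^ 2 * s) = s := by linear_combination s * omega_pow_three
    exact (congrArg (· ∈ 𝒮) this).mpr hs
  · exact ⟨k, hk, rfl⟩

/-- On the domain of the `j`-th column of `μ₃`, the real part of `l_j` is the smallest. -/
theorem re_l_le_of_mem_columnDomain {j : Fin 3} {k : ℂ} (hk : k ∈ columnDomain j) (i : Fin 3) :
    (l k j).re ≤ (l k i).re := by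
  -- The orderings of all four sectors in `𝒮` begin with label `2`; the other two columns reduce to
  -- this one by rotating back once or twice.
  have key : ∀ s ∈ 𝒮, ∀ i, (l s 2).re ≤ (l s i).re := by
    rintro s (((h | h) | h) | h) i <;> obtain ⟨h₁, h₂, -, -⟩ := h <;> fin_cases i <;>
      simp only [Fin.zero_eta, Fin.mk_one, Fin.reduceFinMk] <;> linarith
  fin_cases j
  · obtain ⟨s, hs, rfl⟩ := hk
    have h := key s hs (i - 1)
    rwa [← l_succ s 2, ← l_succ s (i - 1), sub_add_cancel] at h
  · obtain ⟨s, hs, rfl⟩ := hk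
    have h := key s hs (i - 1 - 1)
    rwa [← l_succ s 2, ← l_succ s (i - 1 - 1), ← l_succ _ (2 + 1), ← l_succ _ (i - 1 - 1 + 1),
      sub_add_cancel, sub_add_cancel, ← mul_assoc, ← pow_two] at h
  · exact key k hk i

/-! ### Weighted contractions -/

section Weighted

variable {X E : Type*} [TopologicalSpace X] [NormedAddCommGroup E] [NormedSpace ℝ E]
  {Y : Set X} {w : X → ℝ}

/-- An affine map `f ↦ e + K f`, whose linear part halves the weighted supremum norm on `Y`, has
a fixed point among the continuous functions dominated by the weight. -/
theorem exists_eq_add_of_weighted_contraction [CompleteSpace E] (hw : ContinuousOn w Y)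
    (hw₁ : ∀ y ∈ Y, 1 ≤ w y) (K : (X → E) → X → E) (e : E)
    (hcont : ∀ f C, ContinuousOn f Y → 0 ≤ C → (∀ y ∈ Y, ‖f y‖ ≤ C * w y) →
      ContinuousOn (K f) Y)
    (hhalf : ∀ f C, 0 ≤ C → (∀ y ∈ Y, ‖f y‖ ≤ C * w y) →
      ∀ y ∈ Y, ‖K f y‖ ≤ C / 2 * w y)
    (hsub : ∀ f g C, ContinuousOn f Y → ContinuousOn g Y → 0 ≤ C →
      (∀ y ∈ Y, ‖f y‖ ≤ C * w y) → (∀ y ∈ Y, ‖g y‖ ≤ C * w y) →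
      ∀ y ∈ Y, K (fun x => f x - g x) y = K f y - K g y) :
    ∃ f C, ContinuousOn f Y ∧ 0 ≤ C ∧ (∀ y ∈ Y, ‖f y‖ ≤ C * w y) ∧ ∀ y ∈ Y, f y = e + K f y := by
  classical
  have hpos : ∀ y ∈ Y, 0 < w y := fun y hy => one_pos.trans_le (hw₁ y hy)
  -- Multiplication by `w` identifies bounded continuous functions on `Y` with continuous functions
  -- dominated by the weight; the value off `Y` is immaterial.
  let F : BoundedContinuousFunction Y E → X → E := fun u x => if h : x ∈ Y then w x • u ⟨x, h⟩ else 0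
  have hF : ∀ u (y : Y), F u y = w y • u y := fun u y => dif_pos y.2
  have hFc : ∀ u, ContinuousOn (F u) Y := fun u => by
    rw [continuousOn_iff_continuous_domRestrict] at hw ⊢
    exact (hw.smul u.continuous).congr fun y => (hF u y).symm
  have hFb : ∀ u, ∀ y ∈ Y, ‖F u y‖ ≤ ‖u‖ * w y := fun u y hy => by
    rw [hF u ⟨y, hy⟩, norm_smul, Real.norm_of_nonneg (hpos y hy).le, mul_comm]
    exact mul_le_mul_of_nonneg_right (u.norm_coe_le_norm _) (hpos y hy).le
  have hwi : Continuous fun y : Y => (w y)⁻¹ :=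
    (continuousOn_iff_continuous_domRestrict.1 hw).inv₀ fun y => (hpos y y.2).ne'
  -- The affine map conjugated by the weight. The bound `1 ≤ w` keeps the constant term `w⁻¹ • e`
  -- bounded.
  let Φ : BoundedContinuousFunction Y E → BoundedContinuousFunction Y E := fun u =>
    BoundedContinuousFunction.ofNormedAddCommGroup (fun y : Y => (w y)⁻¹ • (e + K (F u) y))
      (hwi.smul (continuous_const.add (continuousOn_iff_continuous_domRestrict.1
        (hcont _ _ (hFc u) (norm_nonneg u) (hFb u))))) (‖e‖ + ‖u‖ / 2) fun y => by
        have h := hpos y y.2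
        rw [norm_smul, norm_inv, Real.norm_of_nonneg h.le, inv_mul_le_iff₀ h]
        have h₁ := hhalf _ _ (norm_nonneg u) (hFb u) y y.2
        have h₂ := norm_add_le e (K (F u) y)
        have h₃ := mul_le_mul_of_nonneg_right (hw₁ y y.2) (norm_nonneg e)
        linarith
  have hΦ : ∀ u (y : Y), Φ u y = (w y)⁻¹ • (e + K (F u) y) := fun _ _ => rfl
  have hcontr : ContractingWith (1 / 2) Φ := by
    refine ⟨by norm_num, LipschitzWith.of_dist_le_mul fun u v => ?_⟩
    refine (BoundedContinuousFunction.dist_le (by positivity)).2 fun y => ?_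
    have h := hpos y y.2
    have hd : ∀ y' ∈ Y, ‖F u y' - F v y'‖ ≤ dist u v * w y' := fun y' hy' => by
      rw [hF u ⟨y', hy'⟩, hF v ⟨y', hy'⟩, ← smul_sub, norm_smul,
        Real.norm_of_nonneg (hpos y' hy').le, mul_comm, ← dist_eq_norm]
      exact mul_le_mul_of_nonneg_right (BoundedContinuousFunction.dist_coe_le_dist _)
        (hpos y' hy').le
    have hK := hhalf _ _ dist_nonneg hd y y.2
    rw [hsub (F u) (F v) (max ‖u‖ ‖v‖) (hFc u) (hFc v) (le_max_of_le_left (norm_nonneg u))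
      (fun y hy => (hFb u y hy).trans
        (mul_le_mul_of_nonneg_right (le_max_left _ _) (hpos y hy).le))
      (fun y hy => (hFb v y hy).trans
        (mul_le_mul_of_nonneg_right (le_max_right _ _) (hpos y hy).le)) y y.2] at hK
    rw [hΦ, hΦ, dist_eq_norm, ← smul_sub, add_sub_add_left_eq_sub, norm_smul, norm_inv,
      Real.norm_of_nonneg h.le, inv_mul_le_iff₀ h]
    refine hK.trans (le_of_eq ?_)
    push_cast
    ring
  obtain ⟨u, hu⟩ : ∃ u, Φ u = u := ⟨_, hcontr.fixedPoint_isFixedPt⟩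
  refine ⟨F u, ‖u‖, hFc u, norm_nonneg u, hFb u, fun y hy => ?_⟩
  have h := hF u ⟨y, hy⟩
  nth_rw 2 [← hu] at h
  rw [h, hΦ, smul_inv_smul₀ (hpos y hy).ne']

end Weighted

/-- Iterating the halving gives the bound `C / 2 ^ n * w y` for every `n`. -/
theorem eq_zero_of_weighted_halving {X E : Type*} [NormedAddCommGroup E] {Y : Set X} {w : X → ℝ}
    {d : X → E} {C : ℝ} (hC : 0 ≤ C)
    (hd : ∀ y ∈ Y, ‖d y‖ ≤ C * w y)
    (hhalf : ∀ C, 0 ≤ C → (∀ y ∈ Y, ‖d y‖ ≤ C * w y) → ∀ y ∈ Y, ‖d y‖ ≤ C / 2 * w y) :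
    ∀ y ∈ Y, d y = 0 := by
  have h : ∀ n : ℕ, ∀ y ∈ Y, ‖d y‖ ≤ C / 2 ^ n * w y := by
    intro n
    induction n with
    | zero => simpa using hd
    | succ n ih =>
      have := hhalf _ (by positivity) ih
      simpa only [pow_succ, div_div] using this
  intro y hy
  have hlim : Tendsto (fun n : ℕ => C / 2 ^ n * w y) atTop (𝓝 (0 * w y)) :=
    (tendsto_const_nhds.div_atTop (tendsto_pow_atTop_atTop_of_one_lt one_lt_two)).mul_const _
  rw [zero_mul] at hlim
  exact norm_le_zero_iff.1 (ge_of_tendsto' hlim fun n => h n y hy)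

/-! ### Exponentially weighted Volterra estimates -/

/-- The majorant `G` satisfies `G' = (b - a) G`, so it integrates exactly. The gain `1 / (b - a)`
can be made as small as desired by raising the rate `b` of the weight above the rate `a` of the
kernel. -/
theorem norm_integral_le_of_le_exp_forward {h : ℝ → ℂ} {s₀ s₁ a b C : ℝ} (hs : s₀ ≤ s₁)
    (hab : a < b) (hC : 0 ≤ C)
    (hh : ∀ s ∈ Icc s₀ s₁, ‖h s‖ ≤ C * Real.exp (a * (s₁ - s)) * Real.exp (b * (s - s₀))) :
    ‖∫ s in s₀..s₁, h s‖ ≤ C / (b - a) * Real.exp (b * (s₁ - s₀)) := by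
  have hba : 0 < b - a := sub_pos.2 hab
  let G : ℝ → ℝ := fun s => C * Real.exp (a * (s₁ - s)) * Real.exp (b * (s - s₀))
  have hG : Continuous G := by fun_prop
  have hderiv : ∀ s ∈ uIcc s₀ s₁, HasDerivAt (fun s => G s / (b - a)) (G s) s := fun s _ => by
    have h₁ : HasDerivAt (fun s => Real.exp (a * (s₁ - s))) (Real.exp (a * (s₁ - s)) * (a * -1)) s :=
      (((hasDerivAt_id s).const_sub s₁).const_mul a).exp
    have h₂ : HasDerivAt (fun s => Real.exp (b * (s - s₀))) (Real.exp (b * (s - s₀)) * (b * 1)) s :=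
      (((hasDerivAt_id s).sub_const s₀).const_mul b).exp
    refine (((h₁.const_mul C).mul h₂).div_const (b - a)).congr_deriv ?_
    simp only [G]
    field_simp
    ring
  refine (intervalIntegral.norm_integral_le_of_norm_le (g := G) hs
    (Eventually.of_forall fun s hs => hh s (Ioc_subset_Icc_self hs))
    (hG.intervalIntegrable _ _)).trans ?_
  rw [intervalIntegral.integral_eq_sub_of_hasDerivAt hderiv (hG.intervalIntegrable _ _)]
  have h₀ : 0 ≤ G s₀ / (b - a) := by positivity
  have h₁ : G s₁ / (b - a) = C / (b - a) * Real.exp (b * (s₁ - s₀)) := by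
    simp only [G, sub_self, mul_zero, Real.exp_zero]
    ring
  linarith

/-- The reflection `s ↦ -s` reduces to the forward case. Backward integration occurs on `γ₁`, which
starts at `t = T`. -/
theorem norm_integral_le_of_le_exp {h : ℝ → ℂ} {s₀ s₁ a b C : ℝ} (hab : a < b) (hC : 0 ≤ C)
    (hh : ∀ s ∈ uIcc s₀ s₁, ‖h s‖ ≤ C * Real.exp (a * |s₁ - s|) * Real.exp (b * |s - s₀|)) :
    ‖∫ s in s₀..s₁, h s‖ ≤ C / (b - a) * Real.exp (b * |s₁ - s₀|) := by
  rcases le_total s₀ s₁ with hs | hs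
  · rw [abs_of_nonneg (sub_nonneg.2 hs)]
    refine norm_integral_le_of_le_exp_forward hs hab hC fun s h => ?_
    have := hh s (by rwa [uIcc_of_le hs])
    rwa [abs_of_nonneg (sub_nonneg.2 h.1), abs_of_nonneg (sub_nonneg.2 h.2)] at this
  · rw [abs_of_nonpos (sub_nonpos.2 hs), intervalIntegral.integral_symm, norm_neg]
    have hI := intervalIntegral.integral_comp_neg (a := -s₀) (b := -s₁) h
    rw [neg_neg, neg_neg] at hI
    rw [← hI]
    have hs' : -(s₁ - s₀) = -s₁ - -s₀ := by ring
    rw [hs']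
    refine norm_integral_le_of_le_exp_forward (neg_le_neg hs) hab hC fun s h => ?_
    have h₁ : s₁ ≤ -s := le_neg_of_le_neg h.2
    have h₂ : -s ≤ s₀ := neg_le_of_neg_le h.1
    have := hh (-s) (by rw [uIcc_of_ge hs]; exact ⟨h₁, h₂⟩)
    rw [abs_of_nonpos (sub_nonpos.2 h₁), abs_of_nonpos (sub_nonpos.2 h₂)] at this
    convert this using 4 <;> ring

/-! ### Bounds for the kernels -/

theorem norm_mulVec_apply_le {V : Matrix (Fin 3) (Fin 3) ℂ} {b : ℝ} (hV : ∀ i j, ‖V i j‖ ≤ b)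
    (u : Fin 3 → ℂ) (i : Fin 3) : ‖V.mulVec u i‖ ≤ 3 * b * ‖u‖ := by
  calc ‖V.mulVec u i‖ ≤ ∑ j, ‖V i j * u j‖ := norm_sum_le Finset.univ fun j => V i j * u j
    _ ≤ ∑ _j : Fin 3, b * ‖u‖ := Finset.sum_le_sum fun j _ => by
        rw [norm_mul]
        exact mul_le_mul (hV i j) (norm_le_pi_norm u j) (norm_nonneg _)
          ((norm_nonneg _).trans (hV i j))
    _ = 3 * b * ‖u‖ := by simp; ring

theorem norm_expFactor_le {k : ℂ} {i j : Fin 3} {a : ℝ} (hl : ‖l k i - l k j‖ ≤ a)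
    (hz : ‖z k i - z k j‖ ≤ a) (ξ τ : ℝ) :
    ‖expFactor k i j ξ τ‖ ≤ Real.exp (a * |ξ|) * Real.exp (a * |τ|) := by
  rw [expFactor, ← Real.exp_add]
  refine (Complex.norm_exp_le_exp_norm _).trans (Real.exp_le_exp.2 ((norm_add_le _ _).trans ?_))
  rw [norm_mul, norm_mul, Complex.norm_real, Complex.norm_real, Real.norm_eq_abs, Real.norm_eq_abs]
  gcongr

theorem norm_expFactor_le_one {k : ℂ} {i j : Fin 3} (h : (l k j).re ≤ (l k i).re) {ξ : ℝ}
    (hξ : ξ ≤ 0) : ‖expFactor k i j ξ 0‖ ≤ 1 := by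
  rw [expFactor, Complex.norm_exp, Real.exp_le_one_iff]
  simpa using mul_nonpos_of_nonneg_of_nonpos (sub_nonneg.2 h) hξ

theorem exists_rate (k : ℂ) (j : Fin 3) :
    ∃ a, 0 ≤ a ∧ ∀ i, ‖l k i - l k j‖ ≤ a ∧ ‖z k i - z k j‖ ≤ a := by
  refine ⟨∑ i, (‖l k i - l k j‖ + ‖z k i - z k j‖), by positivity, fun i => ?_⟩
  have h := Finset.single_le_sum (f := fun i => ‖l k i - l k j‖ + ‖z k i - z k j‖)
    (fun i _ => by positivity) (Finset.mem_univ i)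
  have h₁ := norm_nonneg (l k i - l k j)
  have h₂ := norm_nonneg (z k i - z k j)
  constructor <;> linarith

theorem continuous_expFactor (k : ℂ) (i j : Fin 3) :
    Continuous fun p : ℝ × ℝ => expFactor k i j p.1 p.2 := by
  unfold expFactor
  fun_prop

/-! ### The potentials -/

section Potentials

variable {T : ℝ} {q r : ℝ → ℝ → ℂ}

theorem IsSolution.continuousOn_V1 (h : IsSolution T q r) (i j : Fin 3) :
    ContinuousOn (fun p : ℝ × ℝ => V1 q r p.1 p.2 i j) (closedDomain T) := by
  have hq := h.smooth_q.cont
  have hr := h.smooth_r.cont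
  fin_cases i <;> fin_cases j <;> simp only [V1] <;>
    first | exact continuousOn_const | exact hq | exact hr

theorem IsSolution.continuousOn_V2 (h : IsSolution T q r) (k : ℂ) (i j : Fin 3) :
    ContinuousOn (fun p : ℝ × ℝ => V2 q r p.1 p.2 k i j) (closedDomain T) := by
  have hq := h.smooth_q.cont
  have hr := h.smooth_r.cont
  have hq' := h.smooth_q.cont_x
  have hr' := h.smooth_r.cont_x
  fin_cases i <;> fin_cases j <;> simp [V2] <;> fun_prop

theorem continuousOn_mulVec {S : Set (ℝ × ℝ)} {V : ℝ × ℝ → Matrix (Fin 3) (Fin 3) ℂ}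
    (hV : ∀ i j, ContinuousOn (fun p => V p i j) S) {f : ℝ × ℝ → Fin 3 → ℂ}
    (hf : ContinuousOn f S) (i : Fin 3) : ContinuousOn (fun p => (V p).mulVec (f p) i) S := by
  simp only [Matrix.mulVec, dotProduct]
  exact continuousOn_finsetSum _ fun j _ => (hV i j).mul (continuousOn_pi.1 hf j)

theorem le_sum_abs (b : Fin 3 → Fin 3 → ℝ) (i j : Fin 3) : b i j ≤ ∑ i, ∑ j, |b i j| := by
  have h₁ : |b i j| ≤ ∑ j, |b i j| :=
    Finset.single_le_sum (f := fun j => |b i j|) (fun _ _ => abs_nonneg _) (Finset.mem_univ j)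
  have h₂ : ∑ j, |b i j| ≤ ∑ i, ∑ j, |b i j| :=
    Finset.single_le_sum (f := fun i => ∑ j, |b i j|)
      (fun _ _ => Finset.sum_nonneg fun _ _ => abs_nonneg _) (Finset.mem_univ i)
  exact (le_abs_self _).trans (h₁.trans h₂)

/-- The vertical legs of the contours lie on `x = 0`, so compactness of `[0, T]` is enough. -/
theorem IsSolution.exists_bound_V2_zero (h : IsSolution T q r) (k : ℂ) :
    ∃ b, 0 ≤ b ∧ ∀ t ∈ Icc 0 T, ∀ i j, ‖V2 q r 0 t k i j‖ ≤ b := by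
  have hij : ∀ i j, ∃ b, ∀ t ∈ Icc 0 T, ‖V2 q r 0 t k i j‖ ≤ b := fun i j => by
    have hc : ContinuousOn (fun t : ℝ => ((0 : ℝ), t)) (Icc 0 T) := by fun_prop
    have hm : MapsTo (fun t : ℝ => ((0 : ℝ), t)) (Icc 0 T) (closedDomain T) :=
      fun t ht => ⟨mem_Ici.2 le_rfl, ht⟩
    have hV : ContinuousOn (fun t => V2 q r 0 t k i j) (Icc 0 T) :=
      ContinuousOn.comp (g := fun p : ℝ × ℝ => V2 q r p.1 p.2 k i j) (f := fun t => ((0 : ℝ), t))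
        (h.continuousOn_V2 k i j) hc hm
    exact isCompact_Icc.exists_bound_of_continuousOn (f := fun t => V2 q r 0 t k i j) hV
  choose b hb using hij
  exact ⟨∑ i, ∑ j, |b i j|, by positivity, fun t ht i j => (hb i j t ht).trans (le_sum_abs b i j)⟩

/-- `V₁` is dominated by an integrable function of `x` that tends to `0`. -/
theorem IsSolution.exists_dominant (h : IsSolution T q r) (hT : 0 ≤ T) :
    ∃ m : ℝ → ℝ, IntegrableOn m (Ioi 0) ∧ Tendsto m atTop (𝓝 0) ∧ (∀ x, 0 ≤ x → 0 ≤ m x) ∧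
      ∀ x t, (x, t) ∈ closedDomain T → ∀ i j, ‖V1 q r x t i j‖ ≤ m x := by
  obtain ⟨m₁, hi₁, hl₁, hm₁⟩ := h.decays_q
  obtain ⟨m₂, hi₂, hl₂, hm₂⟩ := h.decays_r
  have h₁ : ∀ x, 0 ≤ x → 0 ≤ m₁ x := fun x hx =>
    (norm_nonneg _).trans (hm₁ x 0 ⟨hx, le_rfl, hT⟩).1
  have h₂ : ∀ x, 0 ≤ x → 0 ≤ m₂ x := fun x hx =>
    (norm_nonneg _).trans (hm₂ x 0 ⟨hx, le_rfl, hT⟩).1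
  refine ⟨fun x => m₁ x + m₂ x, hi₁.add hi₂, by simpa using hl₁.add hl₂,
    fun x hx => add_nonneg (h₁ x hx) (h₂ x hx), fun x t hxt i j => ?_⟩
  have a₁ := h₁ x hxt.1
  have a₂ := h₂ x hxt.1
  have b₁ := (hm₁ x t hxt).1
  have b₂ := (hm₂ x t hxt).1
  fin_cases i <;> fin_cases j <;> simp [V1] <;> linarith

/-- The dominating function controls large `x` but may be unbounded elsewhere; there continuity on a
compact rectangle supplies the bound. -/
theorem IsSolution.exists_bound_V1 (h : IsSolution T q r) (hT : 0 ≤ T) :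
    ∃ b, 0 ≤ b ∧ ∀ x t, (x, t) ∈ closedDomain T → ∀ i j, ‖V1 q r x t i j‖ ≤ b := by
  obtain ⟨m, -, hlim, -, hm⟩ := h.exists_dominant hT
  obtain ⟨N, hN⟩ := eventually_atTop.1 (hlim.eventually (eventually_le_nhds one_pos))
  have hij : ∀ i j, ∃ b, ∀ p ∈ Icc 0 N ×ˢ Icc 0 T, ‖V1 q r p.1 p.2 i j‖ ≤ b := fun i j =>
    (isCompact_Icc.prod isCompact_Icc).exists_bound_of_continuousOn
      ((h.continuousOn_V1 i j).mono (prod_mono_left Icc_subset_Ici_self))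
  choose b hb using hij
  refine ⟨1 + ∑ i, ∑ j, |b i j|, by positivity, fun x t hxt i j => ?_⟩
  rcases le_total x N with hx | hx
  · have := hb i j (x, t) ⟨⟨hxt.1, hx⟩, hxt.2⟩
    exact this.trans ((le_sum_abs b i j).trans (le_add_of_nonneg_left zero_le_one))
  · have h₁ := (hm x t hxt i j).trans (hN x hx)
    have h₂ : 0 ≤ ∑ i, ∑ j, |b i j| := by positivity
    linarith

end Potentials

/-! ### Continuity of integrals over the contours -/

section Continuity

variable {T : ℝ}

/-- The retraction of the plane onto the closed half-line domain. -/
def retract (T : ℝ) (p : ℝ × ℝ) : ℝ × ℝ := (max 0 p.1, max 0 (min T p.2))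

theorem continuous_retract (T : ℝ) : Continuous (retract T) := by
  unfold retract
  fun_prop

theorem retract_mem (hT : 0 ≤ T) (p : ℝ × ℝ) : retract T p ∈ closedDomain T :=
  ⟨mem_Ici.2 (le_max_left _ _), le_max_left _ _, max_le hT (min_le_left _ _)⟩

theorem retract_of_mem {p : ℝ × ℝ} (hp : p ∈ closedDomain T) : retract T p = p := by
  obtain ⟨h₁, h₂, h₃⟩ := hp
  simp [retract, max_eq_right (mem_Ici.1 h₁), max_eq_right h₂, min_eq_right h₃]

theorem retract_mk {x t : ℝ} (hx : 0 ≤ x) (ht : t ∈ Icc 0 T) : retract T (x, t) = (x, t) :=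
  retract_of_mem ⟨hx, ht⟩

/-- Extends a function continuous on the closed domain to the whole plane, so that theorems on
parametric integrals of globally continuous integrands apply. -/
theorem continuous_comp_retract (hT : 0 ≤ T) {h : ℝ × ℝ → ℂ} (hh : ContinuousOn h (closedDomain T)) :
    Continuous fun p => h (retract T p) :=
  hh.comp_continuous (continuous_retract T) (retract_mem hT)

theorem continuousOn_integral_horizontal (hT : 0 ≤ T) {e : ℝ → ℝ → ℂ}
    (he : Continuous (Function.uncurry e)) {h : ℝ × ℝ → ℂ} (hh : ContinuousOn h (closedDomain T)) :
    ContinuousOn (fun p : ℝ × ℝ => ∫ s in (0 : ℝ)..p.1, e p.1 s * h (s, p.2)) (closedDomain T) := by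
  have hH := continuous_comp_retract hT hh
  have he' : Continuous fun y : (ℝ × ℝ) × ℝ => e y.1.1 y.2 :=
    he.comp (by fun_prop : Continuous fun y : (ℝ × ℝ) × ℝ => (y.1.1, y.2))
  have hH' : Continuous fun y : (ℝ × ℝ) × ℝ => h (retract T (y.2, y.1.2)) :=
    hH.comp (by fun_prop : Continuous fun y : (ℝ × ℝ) × ℝ => (y.2, y.1.2))
  refine (intervalIntegral.continuous_parametric_intervalIntegral_of_continuous (μ := volume)
    (a₀ := 0) (f := fun (p : ℝ × ℝ) s => e p.1 s * h (retract T (s, p.2))) (he'.mul hH')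
    continuous_fst).continuousOn.congr fun p hp => ?_
  refine intervalIntegral.integral_congr fun s hs => ?_
  rw [uIcc_of_le hp.1] at hs
  rw [retract_mk hs.1 hp.2]

theorem continuousOn_integral_vertical (hT : 0 ≤ T) {t₀ : ℝ} (ht₀ : t₀ ∈ Icc 0 T)
    {e : ℝ → ℝ → ℝ → ℂ} (he : Continuous fun y : (ℝ × ℝ) × ℝ => e y.1.1 y.1.2 y.2) {h : ℝ × ℝ → ℂ}
    (hh : ContinuousOn h (closedDomain T)) :
    ContinuousOn (fun p : ℝ × ℝ => ∫ s in t₀..p.2, e p.1 p.2 s * h (0, s)) (closedDomain T) := by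
  have hH := continuous_comp_retract hT hh
  have hH' : Continuous fun y : (ℝ × ℝ) × ℝ => h (retract T (0, y.2)) :=
    hH.comp (by fun_prop : Continuous fun y : (ℝ × ℝ) × ℝ => ((0 : ℝ), y.2))
  refine (intervalIntegral.continuous_parametric_intervalIntegral_of_continuous (μ := volume)
    (a₀ := t₀) (f := fun (p : ℝ × ℝ) s => e p.1 p.2 s * h (retract T (0, s))) (he.mul hH')
    continuous_snd).continuousOn.congr fun p hp => ?_
  refine intervalIntegral.integral_congr fun s hs => ?_
  rw [retract_mk le_rfl (uIcc_subset_Icc ht₀ hp.2 hs)]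

theorem integrableOn_Ioi_mul {e : ℝ → ℂ} (he : Continuous e) {x : ℝ} (hx : 0 ≤ x)
    (he₁ : ∀ s, x < s → ‖e s‖ ≤ 1) {h : ℝ × ℝ → ℂ} (hh : ContinuousOn h (closedDomain T))
    {g : ℝ → ℝ} (hg : IntegrableOn g (Ioi 0)) (hhg : ∀ p ∈ closedDomain T, ‖h p‖ ≤ g p.1)
    {t : ℝ} (ht : t ∈ Icc 0 T) : IntegrableOn (fun s => e s * h (s, t)) (Ioi x) := by
  have hc : ContinuousOn (fun s => e s * h (s, t)) (Ioi x) :=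
    he.continuousOn.mul (hh.comp (by fun_prop : Continuous fun s : ℝ => (s, t)).continuousOn
      fun s hs => ⟨hx.trans hs.le, ht⟩)
  refine (hg.mono_set (Ioi_subset_Ioi hx)).mono' (hc.aestronglyMeasurable measurableSet_Ioi) ?_
  filter_upwards [ae_restrict_mem measurableSet_Ioi] with s hs
  rw [norm_mul]
  have h₁ := hhg (s, t) ⟨hx.trans (mem_Ioi.1 hs).le, ht⟩
  have h₂ := mul_le_mul (he₁ s hs) h₁ (norm_nonneg _) zero_le_one
  simpa using h₂

/-- With `exp (α x)` factored out, the integral over `(x, ∞)` is the one over `(0, ∞)`, continuous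
in `t` by dominated convergence, minus the one over `(0, x)`. -/
theorem continuousOn_integral_Ioi (hT : 0 ≤ T) {α : ℂ} (hα : 0 ≤ α.re) {h : ℝ × ℝ → ℂ}
    (hh : ContinuousOn h (closedDomain T)) {g : ℝ → ℝ} (hg : IntegrableOn g (Ioi 0))
    (hhg : ∀ p ∈ closedDomain T, ‖h p‖ ≤ g p.1) :
    ContinuousOn (fun p : ℝ × ℝ => ∫ s in Ioi p.1, Complex.exp (α * ((p.1 - s : ℝ) : ℂ)) * h (s, p.2))
      (closedDomain T) := by
  let e : ℝ → ℂ := fun s => Complex.exp (-(α * s))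
  have hec : Continuous e := by fun_prop
  have he₁ : ∀ s, 0 < s → ‖e s‖ ≤ 1 := fun s hs => by
    rw [Complex.norm_exp, Real.exp_le_one_iff]
    simpa using mul_nonneg hα hs.le
  have hH := continuous_comp_retract hT hh
  have hint : ∀ t ∈ Icc 0 T, IntegrableOn (fun s => e s * h (s, t)) (Ioi 0) := fun t ht =>
    integrableOn_Ioi_mul hec le_rfl he₁ hh hg hhg ht
  have hG : Continuous fun t => ∫ s in Ioi (0 : ℝ), e s * h (retract T (s, t)) := by
    refine continuous_of_dominated (bound := g) (fun t => ?_) (fun t => ?_) hg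
      (Eventually.of_forall fun s => ?_)
    · exact (hec.mul (hH.comp (by fun_prop : Continuous fun s : ℝ => (s, t)))).aestronglyMeasurable
    · filter_upwards [ae_restrict_mem measurableSet_Ioi] with s hs
      have h₁ := hhg _ (retract_mem hT (s, t))
      have h₂ : (retract T (s, t)).1 = s := max_eq_right (mem_Ioi.1 hs).le
      rw [h₂] at h₁
      rw [norm_mul]
      simpa using mul_le_mul (he₁ s hs) h₁ (norm_nonneg _) zero_le_one
    · exact continuous_const.mul (hH.comp (by fun_prop : Continuous fun t : ℝ => (s, t)))
  have hG₂ := continuousOn_integral_horizontal hT (e := fun _ s => e s)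
    (hec.comp continuous_snd) hh
  refine ContinuousOn.congr (f := fun p : ℝ × ℝ => Complex.exp (α * p.1) *
    ((∫ s in Ioi (0 : ℝ), e s * h (retract T (s, p.2))) - ∫ s in (0 : ℝ)..p.1, e s * h (s, p.2)))
    ?_ fun p hp => ?_
  · exact (by fun_prop : Continuous fun p : ℝ × ℝ => Complex.exp (α * p.1)).continuousOn.mul
      ((hG.comp continuous_snd).continuousOn.sub hG₂)
  · have h₁ : (∫ s in Ioi (0 : ℝ), e s * h (retract T (s, p.2))) =
        ∫ s in Ioi (0 : ℝ), e s * h (s, p.2) :=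
      setIntegral_congr_fun measurableSet_Ioi fun s hs => by
        rw [retract_mk (mem_Ioi.1 hs).le hp.2]
    have hi := hint p.2 hp.2
    beta_reduce
    rw [h₁, ← intervalIntegral.integral_Ioi_sub_Ioi hi hp.1, sub_sub_cancel,
      ← integral_const_mul]
    refine setIntegral_congr_fun measurableSet_Ioi fun s _ => ?_
    simp only [e]
    rw [← mul_assoc, ← Complex.exp_add]
    congr 2
    push_cast
    ring

end Continuity

/-! ### The eigenfunctions `μ₁` and `μ₂` -/

section Path

variable {T : ℝ} {q r : ℝ → ℝ → ℂ}

/-- The integral along `x = 0` from `(0, t₀)` and then horizontally, as an operator on columns. -/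
noncomputable def pathOp (q r : ℝ → ℝ → ℂ) (k : ℂ) (j : Fin 3) (t₀ : ℝ) (f : ℝ × ℝ → Fin 3 → ℂ) (p : ℝ × ℝ) :
    Fin 3 → ℂ := fun i =>
  vertical q r k i j (fun x t => f (x, t)) t₀ p.1 p.2 +
    horizontal q r k i j (fun x t => f (x, t)) p.1 p.2

theorem IsSolution.continuousOn_V1_mulVec (h : IsSolution T q r) {f : ℝ × ℝ → Fin 3 → ℂ}
    (hf : ContinuousOn f (closedDomain T)) (i : Fin 3) :
    ContinuousOn (fun p : ℝ × ℝ => (V1 q r p.1 p.2).mulVec (f p) i) (closedDomain T) :=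
  continuousOn_mulVec (V := fun p => V1 q r p.1 p.2) h.continuousOn_V1 hf i

theorem IsSolution.continuousOn_V2_mulVec (h : IsSolution T q r) (k : ℂ) {f : ℝ × ℝ → Fin 3 → ℂ}
    (hf : ContinuousOn f (closedDomain T)) (i : Fin 3) :
    ContinuousOn (fun p : ℝ × ℝ => (V2 q r p.1 p.2 k).mulVec (f p) i) (closedDomain T) :=
  continuousOn_mulVec (V := fun p => V2 q r p.1 p.2 k) (h.continuousOn_V2 k) hf i

theorem continuousOn_pathOp (h : IsSolution T q r) (hT : 0 ≤ T) {t₀ : ℝ} (ht₀ : t₀ ∈ Icc 0 T)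
    (k : ℂ) (j : Fin 3) {f : ℝ × ℝ → Fin 3 → ℂ} (hf : ContinuousOn f (closedDomain T)) :
    ContinuousOn (pathOp q r k j t₀ f) (closedDomain T) := by
  refine continuousOn_pi.2 fun i => ContinuousOn.add ?_ ?_
  · refine continuousOn_integral_vertical hT ht₀ (e := fun x t s => expFactor k i j x (t - s))
      (h := fun p => (V2 q r p.1 p.2 k).mulVec (f p) i) ?_ (h.continuousOn_V2_mulVec k hf i)
    exact (continuous_expFactor k i j).comp
      (by fun_prop : Continuous fun y : (ℝ × ℝ) × ℝ => (y.1.1, y.1.2 - y.2))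
  · refine continuousOn_integral_horizontal hT (e := fun x s => expFactor k i j (x - s) 0)
      (h := fun p => (V1 q r p.1 p.2).mulVec (f p) i) ?_ (h.continuousOn_V1_mulVec hf i)
    exact (continuous_expFactor k i j).comp
      (by fun_prop : Continuous fun y : ℝ × ℝ => (y.1 - y.2, (0 : ℝ)))

theorem pathOp_sub (h : IsSolution T q r) {t₀ : ℝ} (ht₀ : t₀ ∈ Icc 0 T) (k : ℂ) (j : Fin 3)
    {f g : ℝ × ℝ → Fin 3 → ℂ} (hf : ContinuousOn f (closedDomain T))
    (hg : ContinuousOn g (closedDomain T)) {p : ℝ × ℝ} (hp : p ∈ closedDomain T) :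
    pathOp q r k j t₀ (fun p => f p - g p) p = pathOp q r k j t₀ f p - pathOp q r k j t₀ g p := by
  have hv : ∀ {f : ℝ × ℝ → Fin 3 → ℂ}, ContinuousOn f (closedDomain T) → ∀ i,
      IntervalIntegrable (fun s => expFactor k i j p.1 (p.2 - s) *
        (V2 q r 0 s k).mulVec (f (0, s)) i) volume t₀ p.2 := by
    intro f hf i
    refine ContinuousOn.intervalIntegrable (ContinuousOn.mul ?_ ?_)
    · exact ((continuous_expFactor k i j).comp
        (by fun_prop : Continuous fun s : ℝ => (p.1, p.2 - s))).continuousOn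
    · exact ContinuousOn.comp (g := fun p : ℝ × ℝ => (V2 q r p.1 p.2 k).mulVec (f p) i)
        (f := fun s => ((0 : ℝ), s)) (h.continuousOn_V2_mulVec k hf i) (by fun_prop)
        fun s hs => ⟨mem_Ici.2 le_rfl, uIcc_subset_Icc ht₀ hp.2 hs⟩
  have hh : ∀ {f : ℝ × ℝ → Fin 3 → ℂ}, ContinuousOn f (closedDomain T) → ∀ i,
      IntervalIntegrable (fun s => expFactor k i j (p.1 - s) 0 *
        (V1 q r s p.2).mulVec (f (s, p.2)) i) volume 0 p.1 := by
    intro f hf i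
    refine ContinuousOn.intervalIntegrable (ContinuousOn.mul ?_ ?_)
    · exact ((continuous_expFactor k i j).comp
        (by fun_prop : Continuous fun s : ℝ => (p.1 - s, (0 : ℝ)))).continuousOn
    · refine (h.continuousOn_V1_mulVec hf i).comp (f := fun s => (s, p.2)) (by fun_prop)
        fun s hs => ⟨?_, hp.2⟩
      rw [uIcc_of_le hp.1] at hs
      exact hs.1
  ext i
  simp only [pathOp, vertical, horizontal, Matrix.mulVec_sub, Pi.sub_apply, mul_sub]
  rw [intervalIntegral.integral_sub (hv hf i) (hv hg i),
    intervalIntegral.integral_sub (hh hf i) (hh hg i)]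
  ring

/-- The exponential weight that makes `pathOp` a contraction. -/
noncomputable def pathWeight (b t₀ : ℝ) (p : ℝ × ℝ) : ℝ := Real.exp (b * p.1) * Real.exp (b * |p.2 - t₀|)

/-- For a large rate, `pathOp` halves the weighted norm; its value at `(x,t)` depends only on the
values at points with first coordinate in `[0, x]`. -/
theorem exists_pathWeight_halving (h : IsSolution T q r) (hT : 0 ≤ T) {t₀ : ℝ}
    (ht₀ : t₀ ∈ Icc 0 T) (k : ℂ) (j : Fin 3) :
    ∃ b, 0 ≤ b ∧ ∀ (f : ℝ × ℝ → Fin 3 → ℂ) (C : ℝ), 0 ≤ C → ∀ p ∈ closedDomain T,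
      (∀ p' ∈ Icc 0 p.1 ×ˢ Icc 0 T, ‖f p'‖ ≤ C * pathWeight b t₀ p') →
      ‖pathOp q r k j t₀ f p‖ ≤ C / 2 * pathWeight b t₀ p := by
  obtain ⟨a, ha, hla⟩ := exists_rate k j
  obtain ⟨b₁, hb₁, hV1⟩ := h.exists_bound_V1 hT
  obtain ⟨b₂, hb₂, hV2⟩ := h.exists_bound_V2_zero k
  -- A leg with potential bound `b'` contributes the factor `3 b' / (b - a)`; the 12 makes it at
  -- most `1/4`, and the 1 keeps `a < b` when both bounds vanish.
  obtain ⟨b, hb⟩ : ∃ b, b = a + (12 * (b₁ + b₂) + 1) := ⟨_, rfl⟩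
  have hab : a < b := by linarith
  have hba : 0 < b - a := sub_pos.2 hab
  refine ⟨b, by linarith, fun f C hC p hp hf => ?_⟩
  obtain ⟨x, t⟩ := p
  have hx : 0 ≤ x := hp.1
  have ht : t ∈ Icc 0 T := hp.2
  simp only [pathWeight] at hf ⊢
  have small : ∀ b', 0 ≤ b' → b' ≤ b₁ + b₂ → ∀ W, 0 ≤ W → 3 * b' * C * W / (b - a) ≤ C / 4 * W :=
    fun b' _ hb'' W hW => by
      rw [div_le_iff₀ hba]
      have h₁ : 12 * b' ≤ b - a := by linarith
      have h₂ := mul_le_mul_of_nonneg_right h₁ (mul_nonneg hC hW)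
      linarith
  refine (pi_norm_le_iff_of_nonneg (by positivity)).2 fun i => ?_
  obtain ⟨hl, hz⟩ := hla i
  have hv : ‖vertical q r k i j (fun x t => f (x, t)) t₀ x t‖ ≤
      C / 4 * (Real.exp (b * x) * Real.exp (b * |t - t₀|)) := by
    refine (norm_integral_le_of_le_exp hab (C := 3 * b₂ * C * Real.exp (a * x)) (by positivity)
      fun s hs => ?_).trans ?_
    · have hs' : s ∈ Icc 0 T := uIcc_subset_Icc ht₀ ht hs
      have h₁ := norm_expFactor_le hl hz x (t - s)
      have h₂ := norm_mulVec_apply_le (hV2 s hs') (f (0, s)) i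
      have h₃ := hf (0, s) ⟨⟨le_rfl, hx⟩, hs'⟩
      simp only [mul_zero, Real.exp_zero, one_mul] at h₃
      rw [norm_mul]
      rw [abs_of_nonneg hx] at h₁
      calc _ ≤ (Real.exp (a * x) * Real.exp (a * |t - s|)) *
            (3 * b₂ * (C * Real.exp (b * |s - t₀|))) :=
            mul_le_mul h₁ (h₂.trans (by gcongr)) (norm_nonneg _) (by positivity)
        _ = _ := by ring
    · have h₁ := small b₂ hb₂ (by linarith) (Real.exp (a * x)) (Real.exp_nonneg _)
      calc _ ≤ C / 4 * Real.exp (a * x) * Real.exp (b * |t - t₀|) := by gcongr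
        _ ≤ C / 4 * Real.exp (b * x) * Real.exp (b * |t - t₀|) := by gcongr
        _ = _ := by ring
  have hh : ‖horizontal q r k i j (fun x t => f (x, t)) x t‖ ≤
      C / 4 * (Real.exp (b * x) * Real.exp (b * |t - t₀|)) := by
    refine (norm_integral_le_of_le_exp hab (C := 3 * b₁ * C * Real.exp (b * |t - t₀|))
      (by positivity) fun s hs => ?_).trans ?_
    · rw [uIcc_of_le hx] at hs
      have h₁ := norm_expFactor_le hl hz (x - s) 0
      have h₂ := norm_mulVec_apply_le (hV1 s t ⟨hs.1, ht⟩) (f (s, t)) i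
      have h₃ := hf (s, t) ⟨hs, ht⟩
      simp only [abs_zero, mul_zero, Real.exp_zero, mul_one] at h₁ h₃
      rw [norm_mul, sub_zero, abs_of_nonneg hs.1]
      calc _ ≤ Real.exp (a * |x - s|) *
            (3 * b₁ * (C * (Real.exp (b * s) * Real.exp (b * |t - t₀|)))) :=
            mul_le_mul h₁ (h₂.trans (by gcongr)) (norm_nonneg _) (by positivity)
        _ = _ := by ring
    · have h₁ := small b₁ hb₁ (by linarith) (Real.exp (b * |t - t₀|)) (Real.exp_nonneg _)
      rw [sub_zero, abs_of_nonneg hx]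
      calc _ ≤ C / 4 * Real.exp (b * |t - t₀|) * Real.exp (b * x) := by gcongr
        _ = _ := by ring
  calc _ ≤ _ := norm_add_le _ _
    _ ≤ _ := add_le_add hv hh
    _ = _ := by ring

theorem continuous_pathWeight (b t₀ : ℝ) : Continuous (pathWeight b t₀) := by
  unfold pathWeight
  fun_prop

theorem one_le_pathWeight {b : ℝ} (hb : 0 ≤ b) (t₀ : ℝ) {p : ℝ × ℝ} (hp : 0 ≤ p.1) :
    1 ≤ pathWeight b t₀ p :=
  one_le_mul_of_one_le_of_one_le (Real.one_le_exp (by positivity)) (Real.one_le_exp (by positivity))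

theorem exists_eq_add_pathOp (h : IsSolution T q r) (hT : 0 ≤ T) {t₀ : ℝ} (ht₀ : t₀ ∈ Icc 0 T)
    (k : ℂ) (j : Fin 3) (e : Fin 3 → ℂ) :
    ∃ f, ContinuousOn f (closedDomain T) ∧ ∀ p ∈ closedDomain T, f p = e + pathOp q r k j t₀ f p := by
  obtain ⟨b, hb, hhalf⟩ := exists_pathWeight_halving h hT ht₀ k j
  obtain ⟨f, -, hf, -, -, hfe⟩ := exists_eq_add_of_weighted_contraction
    (continuous_pathWeight b t₀).continuousOn (fun p hp => one_le_pathWeight hb t₀ hp.1)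
    (pathOp q r k j t₀) e (fun f C hf _ _ => continuousOn_pathOp h hT ht₀ k j hf)
    (fun f C hC hf p hp => hhalf f C hC p hp fun p' hp' => hf p' ⟨hp'.1.1, hp'.2⟩)
    (fun f g C hf hg _ _ _ p hp => pathOp_sub h ht₀ k j hf hg hp)
  exact ⟨f, hf, hfe⟩

/-- No growth condition is imposed as `x → ∞`. The operator at `p` sees only first coordinates in
`[0, p.1]`, so the halving can be iterated on that compact rectangle, where the difference is
bounded. -/
theorem eq_of_eq_add_pathOp (h : IsSolution T q r) (hT : 0 ≤ T) {t₀ : ℝ} (ht₀ : t₀ ∈ Icc 0 T)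
    (k : ℂ) (j : Fin 3) (e : Fin 3 → ℂ) {f g : ℝ × ℝ → Fin 3 → ℂ}
    (hf : ContinuousOn f (closedDomain T)) (hg : ContinuousOn g (closedDomain T))
    (hfe : ∀ p ∈ closedDomain T, f p = e + pathOp q r k j t₀ f p)
    (hge : ∀ p ∈ closedDomain T, g p = e + pathOp q r k j t₀ g p) :
    ∀ p ∈ closedDomain T, f p = g p := by
  obtain ⟨b, hb, hhalf⟩ := exists_pathWeight_halving h hT ht₀ k j
  intro p hp
  have hsub : Icc 0 p.1 ×ˢ Icc 0 T ⊆ closedDomain T := prod_mono_left Icc_subset_Ici_self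
  obtain ⟨C, hC⟩ := (isCompact_Icc.prod isCompact_Icc).exists_bound_of_continuousOn
    ((hf.sub hg).mono hsub)
  have hd : ∀ p' ∈ Icc 0 p.1 ×ˢ Icc 0 T, ‖f p' - g p'‖ ≤ |C| * pathWeight b t₀ p' := fun p' hp' =>
    ((hC p' hp').trans (le_abs_self C)).trans
      (le_mul_of_one_le_right (abs_nonneg C) (one_le_pathWeight hb t₀ hp'.1.1))
  refine sub_eq_zero.1 (eq_zero_of_weighted_halving (d := fun p => f p - g p) (abs_nonneg C) hd
    (fun C hC hd p' hp' => ?_) p ⟨⟨hp.1, le_rfl⟩, hp.2⟩)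
  have hK := hhalf (fun p => f p - g p) C hC p' (hsub hp') fun p'' hp'' =>
    hd p'' ⟨⟨hp''.1.1, hp''.1.2.trans hp'.1.2⟩, hp''.2⟩
  rw [pathOp_sub h ht₀ k j hf hg (hsub hp')] at hK
  rwa [hfe p' (hsub hp'), hge p' (hsub hp'), add_sub_add_left_eq_sub]

theorem wellPosed_isMuColumn_path (h : IsSolution T q r) (hT : 0 ≤ T) {t₀ : ℝ}
    (ht₀ : t₀ ∈ Icc 0 T) (k : ℂ) (j : Fin 3) {γ : Contour} (hγ : γ ≠ Contour.γ₃)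
    (hγ₀ : ∀ i v x t, contourIntegral T q r k i j v x t γ =
      vertical q r k i j v t₀ x t + horizontal q r k i j v x t) :
    WellPosed T (IsMuColumn T q r γ k j) := by
  have hsol : ∀ v, SolvesColumn T q r k (fun _ => γ) j v ↔ ∀ p ∈ closedDomain T,
      v p.1 p.2 = (fun i => (1 : Matrix (Fin 3) (Fin 3) ℂ) i j) +
        pathOp q r k j t₀ (fun p => v p.1 p.2) p := fun v => by
    simp only [SolvesColumn, Prod.forall, funext_iff, Pi.add_apply, pathOp, hγ₀]
  constructor
  · obtain ⟨f, hf, hfe⟩ := exists_eq_add_pathOp h hT ht₀ k j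
      fun i => (1 : Matrix (Fin 3) (Fin 3) ℂ) i j
    exact ⟨fun x t => f (x, t), hf, fun hc => absurd hc hγ, (hsol _).2 hfe⟩
  · intro v w hv hw x t hxt
    exact eq_of_eq_add_pathOp h hT ht₀ k j _ hv.1 hw.1 ((hsol v).1 hv.2.2) ((hsol w).1 hw.2.2)
      (x, t) hxt

end Path

/-! ### The eigenfunction `μ₃` -/

section Tail

variable {T : ℝ} {q r : ℝ → ℝ → ℂ}

/-- The integral along the horizontal ray from `(∞, t)` to `(x, t)`, as an operator on columns. -/
noncomputable def tailOp (q r : ℝ → ℝ → ℂ) (k : ℂ) (j : Fin 3) (f : ℝ × ℝ → Fin 3 → ℂ) (p : ℝ × ℝ) :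
    Fin 3 → ℂ := fun i =>
  -∫ s in Ioi p.1, expFactor k i j (p.1 - s) 0 * ((V1 q r s p.2).mulVec (f (s, p.2))) i

theorem IsSolution.exists_integrable_bound_V1_mulVec (h : IsSolution T q r) (hT : 0 ≤ T)
    {f : ℝ × ℝ → Fin 3 → ℂ} {C : ℝ} (hf : ∀ p ∈ closedDomain T, ‖f p‖ ≤ C) :
    ∃ g : ℝ → ℝ, IntegrableOn g (Ioi 0) ∧
      ∀ i, ∀ p ∈ closedDomain T, ‖(V1 q r p.1 p.2).mulVec (f p) i‖ ≤ g p.1 := by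
  obtain ⟨m, hm, -, hm₀, hV⟩ := h.exists_dominant hT
  refine ⟨fun s => 3 * m s * C, (hm.const_mul 3).mul_const C, fun i p hp => ?_⟩
  refine (norm_mulVec_apply_le (hV p.1 p.2 hp) (f p) i).trans ?_
  have := hm₀ p.1 hp.1
  exact mul_le_mul_of_nonneg_left (hf p hp) (by positivity)

theorem continuousOn_tailOp (h : IsSolution T q r) (hT : 0 ≤ T) {k : ℂ} {j : Fin 3}
    (hk : ∀ i, (l k j).re ≤ (l k i).re) {f : ℝ × ℝ → Fin 3 → ℂ}
    (hf : ContinuousOn f (closedDomain T)) {C : ℝ} (hfC : ∀ p ∈ closedDomain T, ‖f p‖ ≤ C) :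
    ContinuousOn (tailOp q r k j f) (closedDomain T) := by
  obtain ⟨g, hg, hVg⟩ := h.exists_integrable_bound_V1_mulVec hT hfC
  refine continuousOn_pi.2 fun i => ContinuousOn.neg ?_
  have hα : 0 ≤ (l k i - l k j).re := by simpa using hk i
  refine (continuousOn_integral_Ioi hT hα (h.continuousOn_V1_mulVec hf i) hg (hVg i)).congr
    fun p _ => ?_
  simp [expFactor]

theorem tailOp_sub (h : IsSolution T q r) (hT : 0 ≤ T) {k : ℂ} {j : Fin 3}
    (hk : ∀ i, (l k j).re ≤ (l k i).re) {f g : ℝ × ℝ → Fin 3 → ℂ}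
    (hf : ContinuousOn f (closedDomain T)) (hg : ContinuousOn g (closedDomain T)) {C : ℝ}
    (hfC : ∀ p ∈ closedDomain T, ‖f p‖ ≤ C) (hgC : ∀ p ∈ closedDomain T, ‖g p‖ ≤ C)
    {p : ℝ × ℝ} (hp : p ∈ closedDomain T) :
    tailOp q r k j (fun p => f p - g p) p = tailOp q r k j f p - tailOp q r k j g p := by
  have hint : ∀ {f : ℝ × ℝ → Fin 3 → ℂ}, ContinuousOn f (closedDomain T) →
      (∀ p ∈ closedDomain T, ‖f p‖ ≤ C) → ∀ i, IntegrableOn (fun s =>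
        expFactor k i j (p.1 - s) 0 * (V1 q r s p.2).mulVec (f (s, p.2)) i) (Ioi p.1) := by
    intro f hf hfC i
    obtain ⟨g, hg, hVg⟩ := h.exists_integrable_bound_V1_mulVec hT hfC
    refine integrableOn_Ioi_mul (e := fun s => expFactor k i j (p.1 - s) 0) ?_ hp.1
      (fun s hs => norm_expFactor_le_one (hk i) (sub_nonpos.2 hs.le))
      (h.continuousOn_V1_mulVec hf i) hg (hVg i) hp.2
    exact (continuous_expFactor k i j).comp
      (by fun_prop : Continuous fun s : ℝ => (p.1 - s, (0 : ℝ)))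
  ext i
  simp only [tailOp, Matrix.mulVec_sub, Pi.sub_apply, mul_sub]
  rw [integral_sub (hint hf hfC i) (hint hg hgC i)]
  ring

/-- The weight that makes `tailOp` a contraction. -/
noncomputable def tailWeight (b N : ℝ) (p : ℝ × ℝ) : ℝ := 1 + Real.exp (b * (N - p.1))

/-- The integrand is at most `3 C min(B, m)` times the weight. The constant part of the weight is
paid for by the small mass of `m` beyond `N`, the exponential part by the large rate `b`. -/
theorem exists_tailWeight_halving (h : IsSolution T q r) (hT : 0 ≤ T) {k : ℂ} {j : Fin 3}
    (hk : ∀ i, (l k j).re ≤ (l k i).re) :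
    ∃ b N, 0 ≤ b ∧ ∀ (f : ℝ × ℝ → Fin 3 → ℂ) (C : ℝ), 0 ≤ C →
      (∀ p ∈ closedDomain T, ‖f p‖ ≤ C * tailWeight b N p) →
      ∀ p ∈ closedDomain T, ‖tailOp q r k j f p‖ ≤ C / 2 * tailWeight b N p := by
  obtain ⟨m, hm, -, hm₀, hVm⟩ := h.exists_dominant hT
  obtain ⟨B, hB, hVB⟩ := h.exists_bound_V1 hT
  -- The value `1/6` cancels the 3 from the matrix product and leaves the factor `1/2`.
  obtain ⟨N, hN₀, hN⟩ : ∃ N, 0 ≤ N ∧ ∫ s in Ioi N, m s ≤ 1 / 6 := by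
    have hlim := (intervalIntegral_tendsto_integral_Ioi 0 hm tendsto_id).const_sub
      (∫ s in Ioi (0 : ℝ), m s)
    rw [sub_self] at hlim
    obtain ⟨N, hN, hN₀⟩ := ((hlim.eventually (eventually_le_nhds (by norm_num : (0 : ℝ) < 1 / 6))).and
      (eventually_ge_atTop 0)).exists
    refine ⟨N, hN₀, ?_⟩
    rwa [id, ← intervalIntegral.integral_Ioi_sub_Ioi hm hN₀, sub_sub_cancel] at hN
  -- Chosen so that `2 B / b ≤ 1/6`, with `b > 0` even if `B = 0`.
  obtain ⟨b, hb⟩ : ∃ b, b = 12 * B + 1 := ⟨_, rfl⟩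
  have hb₀ : 0 < b := by linarith
  refine ⟨b, N, hb₀.le, fun f C hC hf p hp => ?_⟩
  obtain ⟨x, t⟩ := p
  have hx : 0 ≤ x := hp.1
  have ht : t ∈ Icc 0 T := hp.2
  simp only [tailWeight] at hf ⊢
  have hexp : IntegrableOn (fun s => Real.exp (b * (N - s))) (Ioi x) := by
    have := (integrableOn_exp_mul_Ioi (neg_lt_zero.2 hb₀) x).const_mul (Real.exp (b * N))
    refine IntegrableOn.congr_fun this (fun s _ => ?_) measurableSet_Ioi
    simp only [← Real.exp_add]
    ring_nf
  have hexp' : ∫ s in Ioi x, Real.exp (b * (N - s)) = Real.exp (b * (N - x)) / b := by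
    have := integral_exp_mul_Ioi (neg_lt_zero.2 hb₀) x
    have h₁ : ∀ s, Real.exp (b * (N - s)) = Real.exp (b * N) * Real.exp (-b * s) := fun s => by
      rw [← Real.exp_add]
      ring_nf
    simp only [h₁, integral_const_mul, this]
    rw [neg_div_neg_eq, mul_div_assoc]
  have hmN : IntegrableOn ((Ioi N).indicator m) (Ioi x) :=
    (hm.mono_set (Ioi_subset_Ioi hx)).indicator measurableSet_Ioi
  have hmN' : ∫ s in Ioi x, (Ioi N).indicator m s ≤ 1 / 6 := by
    rw [setIntegral_indicator measurableSet_Ioi]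
    refine (setIntegral_mono_set (hm.mono_set (Ioi_subset_Ioi hN₀)) ?_
      inter_subset_right.eventuallyLE).trans hN
    filter_upwards [ae_restrict_mem measurableSet_Ioi] with s hs
    exact hm₀ s (hN₀.trans (mem_Ioi.1 hs).le)
  refine (pi_norm_le_iff_of_nonneg (by positivity)).2 fun i => ?_
  have hbound : ∀ s ∈ Ioi x, ‖expFactor k i j (x - s) 0 * (V1 q r s t).mulVec (f (s, t)) i‖ ≤
      3 * C * (2 * B * Real.exp (b * (N - s)) + (Ioi N).indicator m s) := by
    intro s hs
    have hs₀ : 0 ≤ s := hx.trans (mem_Ioi.1 hs).le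
    have hst : (s, t) ∈ closedDomain T := ⟨hs₀, ht⟩
    have h₁ := norm_expFactor_le_one (hk i) (sub_nonpos.2 (mem_Ioi.1 hs).le)
    have h₂ := norm_mulVec_apply_le (fun i j => le_min (hVB s t hst i j) (hVm s t hst i j)) (f (s, t)) i
    -- Beyond `N` the summand `1` is charged to `m`; up to `N` it is at most the exponential, which
    -- explains the factor 2.
    have h₃ : min B (m s) * (1 + Real.exp (b * (N - s))) ≤
        2 * B * Real.exp (b * (N - s)) + (Ioi N).indicator m s := by
      have hE := Real.exp_pos (b * (N - s))
      have hBE := mul_nonneg hB hE.le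
      have h₄ := mul_le_mul_of_nonneg_right (min_le_left B (m s)) hE.le
      by_cases hsN : s ∈ Ioi N
      · rw [indicator_of_mem hsN]
        have h₅ := min_le_right B (m s)
        linarith
      · rw [indicator_of_notMem hsN]
        have hE₁ : 1 ≤ Real.exp (b * (N - s)) :=
          Real.one_le_exp (mul_nonneg hb₀.le (sub_nonneg.2 (not_lt.1 hsN)))
        have h₅ := min_le_left B (m s)
        have h₆ := le_mul_of_one_le_right hB hE₁
        linarith
    have hmin : 0 ≤ min B (m s) := le_min hB (hm₀ s hs₀)
    rw [norm_mul]
    calc _ ≤ 1 * (3 * min B (m s) * (C * (1 + Real.exp (b * (N - s))))) :=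
          mul_le_mul h₁ (h₂.trans (mul_le_mul_of_nonneg_left (hf _ hst) (by positivity)))
            (norm_nonneg _) zero_le_one
      _ = 3 * C * (min B (m s) * (1 + Real.exp (b * (N - s)))) := by ring
      _ ≤ _ := mul_le_mul_of_nonneg_left h₃ (by positivity)
  rw [tailOp, norm_neg]
  refine (norm_integral_le_of_norm_le (((hexp.const_mul (2 * B)).add hmN).const_mul (3 * C))
    ((ae_restrict_iff' measurableSet_Ioi).2 (Eventually.of_forall hbound))).trans ?_
  simp only [Pi.add_apply]
  rw [integral_const_mul, integral_add (hexp.const_mul (2 * B)) hmN, integral_const_mul, hexp']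
  have hE := Real.exp_pos (b * (N - x))
  have h₁ : 2 * B * (Real.exp (b * (N - x)) / b) ≤ 1 / 6 * Real.exp (b * (N - x)) := by
    rw [← mul_div_assoc, div_le_iff₀ hb₀, hb]
    have := mul_nonneg hB hE.le
    rw [hb] at this hE
    linarith
  calc _ ≤ 3 * C * (1 / 6 * Real.exp (b * (N - x)) + 1 / 6) :=
        mul_le_mul_of_nonneg_left (add_le_add h₁ hmN') (by positivity)
    _ = _ := by ring

/-- On the domain the weight lies between `1` and `1 + exp (b N)`, so the functions it dominates are
exactly the bounded ones, the class in which `μ₃` is sought. -/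
theorem wellPosed_isMuColumn_tail (h : IsSolution T q r) (hT : 0 ≤ T) {k : ℂ} {j : Fin 3}
    (hk : ∀ i, (l k j).re ≤ (l k i).re) : WellPosed T (IsMuColumn T q r Contour.γ₃ k j) := by
  obtain ⟨b, N, hb, hhalf⟩ := exists_tailWeight_halving h hT hk
  have hsol : ∀ v, SolvesColumn T q r k (fun _ => Contour.γ₃) j v ↔ ∀ p ∈ closedDomain T,
      v p.1 p.2 = (fun i => (1 : Matrix (Fin 3) (Fin 3) ℂ) i j) +
        tailOp q r k j (fun p => v p.1 p.2) p := fun v => by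
    simp only [SolvesColumn, Prod.forall, funext_iff, Pi.add_apply, tailOp, contourIntegral]
  have hw₁ : ∀ p, 1 ≤ tailWeight b N p := fun p => le_add_of_nonneg_right (Real.exp_nonneg _)
  have hbdd : ∀ {f : ℝ × ℝ → Fin 3 → ℂ} {C : ℝ}, 0 ≤ C →
      (∀ p ∈ closedDomain T, ‖f p‖ ≤ C * tailWeight b N p) →
      ∀ p ∈ closedDomain T, ‖f p‖ ≤ C * (1 + Real.exp (b * N)) := fun hC hf p hp => by
    refine (hf p hp).trans (mul_le_mul_of_nonneg_left (add_le_add_right (Real.exp_le_exp.2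
      (mul_le_mul_of_nonneg_left ?_ hb)) 1) hC)
    exact sub_le_self N hp.1
  constructor
  · obtain ⟨f, C, hf, hC, hfC, hfe⟩ := exists_eq_add_of_weighted_contraction
      (Y := closedDomain T) (w := tailWeight b N)
      (by unfold tailWeight; fun_prop) (fun p _ => hw₁ p)
      (tailOp q r k j) (fun i => (1 : Matrix (Fin 3) (Fin 3) ℂ) i j)
      (fun f C hf hC hfC => continuousOn_tailOp h hT hk hf (hbdd hC hfC))
      (fun f C hC hf => hhalf f C hC hf)
      (fun f g C hf hg hC hfC hgC p hp =>
        tailOp_sub h hT hk hf hg (hbdd hC hfC) (hbdd hC hgC) hp)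
    exact ⟨fun x t => f (x, t), hf, fun _ => ⟨_, fun x t hxt => hbdd hC hfC (x, t) hxt⟩,
      (hsol _).2 hfe⟩
  · intro v w hv hw x t hxt
    obtain ⟨C₁, hC₁⟩ := hv.2.1 rfl
    obtain ⟨C₂, hC₂⟩ := hw.2.1 rfl
    have hv₂ := (hsol v).1 hv.2.2
    have hw₂ := (hsol w).1 hw.2.2
    have hd : ∀ p ∈ closedDomain T, ‖v p.1 p.2 - w p.1 p.2‖ ≤ |C₁ + C₂| * tailWeight b N p :=
      fun p hp => ((norm_sub_le_of_le (hC₁ _ _ hp) (hC₂ _ _ hp)).trans (le_abs_self _)).trans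
        (le_mul_of_one_le_right (abs_nonneg _) (hw₁ p))
    refine sub_eq_zero.1 (eq_zero_of_weighted_halving (d := fun p : ℝ × ℝ => v p.1 p.2 - w p.1 p.2)
      (abs_nonneg _) hd (fun C hC hd p hp => ?_) (x, t) hxt)
    have hK := hhalf _ C hC hd p hp
    rw [tailOp_sub h hT hk hv.1 hw.1 (C := max C₁ C₂)
      (fun p hp => (hC₁ _ _ hp).trans (le_max_left _ _))
      (fun p hp => (hC₂ _ _ hp).trans (le_max_right _ _)) hp] at hK
    rwa [hv₂ p hp, hw₂ p hp, add_sub_add_left_eq_sub]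

end Tail

end LaxThree

/-! ### The cyclic symmetry of the eigenfunctions. -/

theorem lemma2p2 (T : ℝ) (hT : 0 < T) (q r : ℝ → ℝ → ℂ) (hqr : LaxThree.IsSolution T q r) :
    -- the sectionally analytic function `M`, away from its singularities
    (∀ k ∈ ⋃ n, LaxThree.D n,
      LaxThree.ω * k ∈ ⋃ n, LaxThree.D n ∧
      (LaxThree.MRegular T q r k ↔ LaxThree.MRegular T q r (LaxThree.ω * k)) ∧
      (LaxThree.MRegular T q r k → ∀ x t, (x, t) ∈ LaxThree.closedDomain T →
        LaxThree.M T q r x t k =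
          LaxThree.𝒜 * LaxThree.M T q r x t (LaxThree.ω * k) * LaxThree.𝒜⁻¹)) ∧
    -- the functions `M_n` on the closed sectors (boundary values of `M` on the rays)
    (∀ n, ∀ k ∈ closure (LaxThree.D n),
      LaxThree.ω * k ∈ closure (LaxThree.D (n + 4)) ∧
      (LaxThree.MnRegular T q r n k ↔ LaxThree.MnRegular T q r (n + 4) (LaxThree.ω * k)) ∧
      (LaxThree.MnRegular T q r n k → ∀ x t, (x, t) ∈ LaxThree.closedDomain T →
        LaxThree.Mn T q r n x t k =
          LaxThree.𝒜 * LaxThree.Mn T q r (n + 4) x t (LaxThree.ω * k) * LaxThree.𝒜⁻¹)) ∧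
    -- `μ₁` and `μ₂` are well defined and symmetric for all complex `k`
    (∀ γ, γ = LaxThree.Contour.γ₁ ∨ γ = LaxThree.Contour.γ₂ → ∀ k : ℂ,
      (∀ j, LaxThree.WellPosed T (LaxThree.IsMuColumn T q r γ k j)) ∧
      ∀ x t, (x, t) ∈ LaxThree.closedDomain T →
        LaxThree.mu T q r γ x t k =
          LaxThree.𝒜 * LaxThree.mu T q r γ x t (LaxThree.ω * k) * LaxThree.𝒜⁻¹) ∧
    -- the columns of `μ₃` are well defined and symmetric on `ω𝒮`, `ω²𝒮`, `𝒮`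
    (∀ j, ∀ k ∈ LaxThree.columnDomain j,
      LaxThree.ω * k ∈ LaxThree.columnDomain (j + 1) ∧
      LaxThree.WellPosed T (LaxThree.IsMuColumn T q r LaxThree.Contour.γ₃ k j) ∧
      ∀ x t, (x, t) ∈ LaxThree.closedDomain T → ∀ i,
        LaxThree.mu T q r LaxThree.Contour.γ₃ x t k i j =
          (LaxThree.𝒜 * LaxThree.mu T q r LaxThree.Contour.γ₃ x t (LaxThree.ω * k)
            * LaxThree.𝒜⁻¹) i j) := by
  refine ⟨fun k hk => ?_, fun n k hk => ⟨LaxThree.omega_mul_mem_closure_D hk,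
    LaxThree.MnRegular_succ, fun h x t hxt => LaxThree.Mn_succ h hxt⟩, fun γ hγ k => ?_,
    fun j k hk => ?_⟩
  · obtain ⟨n, hn⟩ := Set.mem_iUnion.1 hk
    have hn' := LaxThree.omega_mul_mem_D.2 hn
    refine ⟨Set.mem_iUnion.2 ⟨n + 4, hn'⟩, ?_, fun h x t hxt => ?_⟩
    · rw [LaxThree.MRegular_iff hn, LaxThree.MRegular_iff hn', LaxThree.MnRegular_succ]
    · rw [LaxThree.M_eq_Mn hn, LaxThree.M_eq_Mn hn']
      exact LaxThree.Mn_succ ((LaxThree.MRegular_iff hn).1 h) hxt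
  · have hwp : ∀ j, LaxThree.WellPosed T (LaxThree.IsMuColumn T q r γ k j) := fun j => by
      -- The two contours differ only in the base time, `T` for `γ₁` and `0` for `γ₂`.
      rcases hγ with rfl | rfl
      · exact LaxThree.wellPosed_isMuColumn_path hqr hT.le (Set.right_mem_Icc.2 hT.le) k j nofun
          fun _ _ _ _ => rfl
      · exact LaxThree.wellPosed_isMuColumn_path hqr hT.le (Set.left_mem_Icc.2 hT.le) k j nofun
          fun _ _ _ _ => rfl
    exact ⟨hwp, fun x t hxt => Matrix.ext fun i j => LaxThree.mu_succ (hwp j) hxt i⟩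
  · have hwp := LaxThree.wellPosed_isMuColumn_tail hqr hT.le
      (LaxThree.re_l_le_of_mem_columnDomain hk)
    exact ⟨LaxThree.omega_mul_mem_columnDomain hk, hwp,
      fun x t hxt i => LaxThree.mu_succ hwp hxt i⟩
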